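/- Let $B^4\subset\mathbb R^4$ be the closed Euclidean unit ball with boundary $S^3$, inclusion $\iota\colon S^3\to B^4$, and $\omega_3=\mathrm{Vol}(S^3)$. For $u\in C^\infty(B^4)$ (smooth up to the boundary) let $g_u=e^{2u}dx^2$. For a metric $g$ let $P=\frac12(\mathrm{Ric}-\frac R6 g)$ be the Schouten tensor, $\sigma_1=\mathrm{tr}_gP$, $\sigma_2=\frac12(\sigma_1^2-|P|_g^2)$, let $H=\frac13\mathrm{tr}_{\iota^*g}\nabla\eta$ be the mean curvature of $S^3$ with respect to the outward unit normal $\eta$ (so $H=1$ for $dx^2$), and let $H_2=H\,\mathrm{tr}_{\iota^*g}(P|_{TS^3})+H^3$. Put \[ \mathcal F_2(u)=\int_0^1\Bigl\{\int_{B^4}u\,\sigma_2^{g_{su}}\,\mathrm{dvol}_{g_{su}}+\oint_{S^3}u\,H_2^{g_{su}}\,\mathrm{dvol}_{\iota^*g_{su}}\Bigr\}\,ds,\qquad \mathcal G_2(u)=\mathcal F_2(u)-\frac{\omega_3}{3}\log\Bigl(\frac1{\omega_3}\oint_{S^3}e^{3u}\Bigr), \] \[ \mathcal C_1=\{u:\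 \sigma_1^{g_u}\ge0 \text{ in } B^4,\ H^{g_u}>0\text{ on }S^3\},\qquad \mathcal V=\{u:\ \mathrm{Vol}_{\iota^*g_u}(S^3)=\omega_3\}. \] Call $u\in A\subset C^\infty(B^4)$ a local minimizer to second order of $F\colon A\to\mathbb R$ if along every smooth curve $(u_t)$ in $A$ with $u_0=u$ one has $F(u_t)\ge F(u)-o(t^2)$ as $t\to0$, that is, if the first variation of $F$ on $A$ at $u$ vanishes and the second is nonnegative; every local minimizer (in the $C^k(B^4)$ topology, for any $k$) is one. Theorem 2. Let $u\in\mathcal C_1$. (1) If $u$ is a local minimizer of $\mathcal F_2\colon\mathcal V\to\mathbb R$, or merely a local minimizer to second order, then $g_u=\Phi^*dx^2$ on $B^4$ for some conformal diffeomorphism $\Phi$ of $B^4$ (mapping $S^3$ to itself). (2) If $u$ is a local minimizer of $\mathcal G_2\colon C^\infty(B^4)\to\mathbb R$, or merely a local minimizer to second order, then $g_u=c\,\Phi^*dx^2$ on $B^4$ for some constant $c>0$ and some conformal diffeomorphism $\Phi$ of $B^4$. -/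

import Mathlib

open MeasureTheory Set Filter Topology
open scoped ContDiff

namespace BallConformal

noncomputable section

/-- Euclidean four-space. -/
abbrev E4 : Type := EuclideanSpace ℝ (Fin 4)

/-- The closed unit ball `B⁴`, a manifold with boundary `S³`. -/
abbrev B4 : Set E4 := Metric.closedBall (0 : E4) 1

/-- The unit sphere `S³ = ∂B⁴`. -/
abbrev S3 : Set E4 := Metric.sphere (0 : E4) 1

/-- The standard surface measure on `S³`. -/
def surf : Measure S3 := (volume : Measure E4).toSphere

/-- `ω₃`, the volume of the standard three-sphere. -/
def omega3 : ℝ := surf.real univ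

/-! ### Riemannian geometry in the standard coordinates of `ℝ⁴` -/

/-- The partial derivative `∂ᵢ f`. -/
def pd (i : Fin 4) (f : E4 → ℝ) (x : E4) : ℝ := fderiv ℝ f x (EuclideanSpace.single i 1)

/-- A Riemannian metric, given by its matrix `g_{ij}` in the standard coordinates. -/
abbrev Metric4 : Type := E4 → Matrix (Fin 4) (Fin 4) ℝ

/-- Christoffel symbols `Γᵏ_{ij}`. -/
def christoffel (g : Metric4) (k i j : Fin 4) (x : E4) : ℝ :=
  (1 / 2) * ∑ l, (g x)⁻¹ k l *
    (pd i (fun y => g y j l) x + pd j (fun y => g y i l) x - pd l (fun y => g y i j) x)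

/-- Ricci tensor `Ric_{ij}` (positive on round spheres). -/
def ricci (g : Metric4) (i j : Fin 4) (x : E4) : ℝ :=
  ∑ k, (pd k (christoffel g k i j) x - pd j (christoffel g k i k) x
    + ∑ l, (christoffel g k k l x * christoffel g l i j x
      - christoffel g k j l x * christoffel g l i k x))

/-- Scalar curvature `R`. -/
def scalarCurv (g : Metric4) (x : E4) : ℝ := ∑ i, ∑ j, (g x)⁻¹ i j * ricci g i j x

/-- Schouten tensor `P = (1/(n-1)) (Ric - R/(2n) g)` in dimension `n + 1 = 4`. -/
def schouten (g : Metric4) (i j : Fin 4) (x : E4) : ℝ :=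
  (1 / 2) * (ricci g i j x - scalarCurv g x / 6 * g x i j)

/-- `σ₁ = tr_g P`. -/
def sigma1 (g : Metric4) (x : E4) : ℝ := ∑ i, ∑ j, (g x)⁻¹ i j * schouten g i j x

/-- `|P|²_g`. -/
def schoutenNormSq (g : Metric4) (x : E4) : ℝ :=
  ∑ i, ∑ j, ∑ k, ∑ l, (g x)⁻¹ i k * (g x)⁻¹ j l * schouten g i j x * schouten g k l x

/-- `σ₂ = (σ₁² - |P|²)/2`, the second elementary symmetric function of the eigenvalues of the
Schouten tensor. -/
def sigma2 (g : Metric4) (x : E4) : ℝ := (1 / 2) * (sigma1 g x ^ 2 - schoutenNormSq g x)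

/-- `g^{ij} x_i x_j`, the squared `g`-length of the conormal `x_i dxⁱ` of `S³`. -/
def conormalSq (g : Metric4) (x : E4) : ℝ := ∑ i, ∑ j, (g x)⁻¹ i j * x i * x j

/-- The outward-pointing `g`-unit normal `ηⁱ = g^{ij} x_j / √(g^{kl} x_k x_l)` of `S³`,
extended by the same formula to the complement of the origin. -/
def normal (g : Metric4) (i : Fin 4) (x : E4) : ℝ :=
  (∑ j, (g x)⁻¹ i j * x j) / Real.sqrt (conormalSq g x)

/-- The covariant derivative `(∇η)_{ij} = g_{jk} (∂ᵢ ηᵏ + Γᵏ_{il} ηˡ)`. -/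
def nablaNormal (g : Metric4) (i j : Fin 4) (x : E4) : ℝ :=
  ∑ k, g x j k * (pd i (normal g k) x + ∑ l, christoffel g k i l x * normal g l x)

/-- The inverse `g^{ij} - ηⁱηʲ` of the metric induced on `TS³`. -/
def tangInv (g : Metric4) (i j : Fin 4) (x : E4) : ℝ :=
  (g x)⁻¹ i j - normal g i x * normal g j x

/-- The mean curvature `H = (1/3) tr_{ι^*g} ∇η` of `S³` (equal to `1` for the flat metric). -/
def meanCurv (g : Metric4) (x : E4) : ℝ :=
  (1 / 3) * ∑ i, ∑ j, tangInv g i j x * nablaNormal g i j x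

/-- The `H₂`-curvature `H tr_{ι^*g}(P|_{TS³}) + (n/3) H³`, `n = 3`, of an umbilic boundary. -/
def H2 (g : Metric4) (x : E4) : ℝ :=
  meanCurv g x * (∑ i, ∑ j, tangInv g i j x * schouten g i j x) + meanCurv g x ^ 3

/-- The density of `dvol_g` with respect to Lebesgue measure. -/
def volDens (g : Metric4) (x : E4) : ℝ := Real.sqrt (g x).det

/-- The density `√(det g · g^{ij} x_i x_j)` of `dvol_{ι^*g}` with respect to the standard surface
measure of `S³`; for `g = e^{2u} dx²` it is `e^{3u}`. -/
def bdryDens (g : Metric4) (x : E4) : ℝ := Real.sqrt ((g x).det * conormalSq g x)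

/-- `Vol_{ι^*g}(S³)`. -/
def bdryVol (g : Metric4) : ℝ := ∫ ξ, bdryDens g (ξ : E4) ∂surf

/-! ### Conformally flat metrics and functionals -/

/-- The conformally flat metric `e^{2u} dx²`. -/
def conf (u : E4 → ℝ) : Metric4 :=
  fun x => Real.exp (2 * u x) • (1 : Matrix (Fin 4) (Fin 4) ℝ)

/-- `C^∞(B⁴)`: functions smooth up to the boundary, represented by smooth extensions to `ℝ⁴`. -/
def smoothFns : Set (E4 → ℝ) := {u | ContDiff ℝ ∞ u}

/-- `e^{2u} dx² ∈ 𝒞₁`: `σ₁ ≥ 0` in `B⁴` and `H > 0` on `S³`. -/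
def coneC1 : Set (E4 → ℝ) :=
  {u | ContDiff ℝ ∞ u ∧ (∀ x ∈ B4, 0 ≤ sigma1 (conf u) x) ∧ ∀ ξ ∈ S3, 0 < meanCurv (conf u) ξ}

/-- `e^{2u} dx² ∈ 𝒱`: the boundary has the volume of the standard sphere. -/
def volV : Set (E4 → ℝ) := {u | ContDiff ℝ ∞ u ∧ bdryVol (conf u) = omega3}

/-- The conformal primitive `ℱ₂` of `(σ₂; H₂)`, relative to the background metric `dx²`. -/
def F2 (u : E4 → ℝ) : ℝ :=
  ∫ s in (0 : ℝ)..1,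
    ((∫ x in B4, u x * sigma2 (conf fun y => s * u y) x * volDens (conf fun y => s * u y) x)
      + ∫ ξ, u (ξ : E4) * H2 (conf fun y => s * u y) (ξ : E4)
          * bdryDens (conf fun y => s * u y) (ξ : E4) ∂surf)

/-- `𝒢₂(u) = ℱ₂(u) - (ω₃/3) log (∮ e^{3u} / ∮ 1)`. -/
def G2 (u : E4 → ℝ) : ℝ :=
  F2 u - omega3 / 3 * Real.log ((∫ ξ, Real.exp (3 * u (ξ : E4)) ∂surf) / omega3)

/-! ### Local minimizers -/

/-- `u` is a local minimizer of `F` on `A` to second order: along every smooth curve `γ_t` in `A`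
with `γ_0 = u` one has `F(γ_t) ≥ F(u) - o(t²)`.  If `t ↦ F(γ_t)` is twice differentiable at `0`,
this says that its first derivative at `0` vanishes and its second one is nonnegative. -/
def IsLocalMinToSecondOrderOn (F : (E4 → ℝ) → ℝ) (A : Set (E4 → ℝ)) (u : E4 → ℝ) : Prop :=
  u ∈ A ∧ ∀ γ : ℝ → E4 → ℝ, ContDiff ℝ ∞ (fun p : ℝ × E4 => γ p.1 p.2) → (∀ t, γ t ∈ A) →
    γ 0 = u → ∀ ε > 0, ∀ᶠ t in 𝓝 (0 : ℝ), F u - ε * t ^ 2 ≤ F (γ t)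

/-- `u` is a local minimizer of `F` on `A` in the `C^k(B⁴)` topology. -/
def IsLocalMinCkOn (k : ℕ) (F : (E4 → ℝ) → ℝ) (A : Set (E4 → ℝ)) (u : E4 → ℝ) : Prop :=
  u ∈ A ∧ ∃ δ > 0, ∀ w ∈ A,
    (∀ j ≤ k, ∀ x ∈ B4, ‖iteratedFDeriv ℝ j (fun y => w y - u y) x‖ < δ) → F u ≤ F w

theorem contDiff_iteratedFDeriv_param (f : ℝ → E4 → ℝ)
    (hf : ContDiff ℝ ∞ (fun p : ℝ × E4 => f p.1 p.2)) (j : ℕ) :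
    ContDiff ℝ ∞ (fun p : ℝ × E4 => iteratedFDeriv ℝ j (f p.1) p.2) := by
  induction j with
  | zero =>
    simp only [iteratedFDeriv_zero_eq_comp, Function.comp_apply]
    exact (continuousMultilinearCurryFin0 ℝ E4 ℝ).symm.contDiff.comp hf
  | succ j ih =>
    have h1 : ContDiff ℝ ∞ (fun p : ℝ × E4 => fderiv ℝ (iteratedFDeriv ℝ j (f p.1)) p.2) :=
      ContDiff.fderiv (f := fun p : ℝ × E4 => iteratedFDeriv ℝ j (f p.1)) (n := ∞)
        (ih.comp ((contDiff_fst.fst).prodMk contDiff_snd)) contDiff_snd (by simp)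
    let L := ((continuousMultilinearCurryLeftEquiv ℝ
      (fun _ : Fin (j + 1) => E4) ℝ).symm.toContinuousLinearEquiv).toContinuousLinearMap
    exact L.contDiff.comp h1

/-- A local minimizer, in the `C^k` topology for any `k`, is a local minimizer to second order. -/
theorem IsLocalMinCkOn.toSecondOrder {k : ℕ} {F : (E4 → ℝ) → ℝ} {A : Set (E4 → ℝ)} {u : E4 → ℝ}
    (h : IsLocalMinCkOn k F A u) : IsLocalMinToSecondOrderOn F A u := by
  obtain ⟨hu, δ, hδ, hmin⟩ := h
  refine ⟨hu, fun γ hγ hA h0 ε hε => ?_⟩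
  have hsub : ContDiff ℝ ∞ (fun p : ℝ × E4 => γ p.1 p.2 - γ 0 p.2) :=
    hγ.sub (hγ.comp (contDiff_const.prodMk contDiff_snd))
  have key : ∀ j ∈ Finset.range (k + 1), ∀ᶠ t in 𝓝 (0 : ℝ), ∀ x ∈ B4,
      ‖iteratedFDeriv ℝ j (fun y => γ t y - γ 0 y) x‖ < δ := by
    intro j _
    have hc := (contDiff_iteratedFDeriv_param (fun t y => γ t y - γ 0 y) hsub j).continuous
    refine (isCompact_closedBall (0 : E4) 1).eventually_forall_of_forall_eventually
      fun x _ => ?_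
    have hx : ‖iteratedFDeriv ℝ j (fun y => γ 0 y - γ 0 y) x‖ < δ := by
      have : iteratedFDeriv ℝ j (fun y => γ 0 y - γ 0 y) x = 0 := by
        simp
      rw [this]; simpa using hδ
    exact (hc.norm.continuousAt (x := ((0 : ℝ), x))).eventually (gt_mem_nhds hx)
  filter_upwards [(Finset.eventually_all _).2 key] with t ht
  have := hmin (γ t) (hA t) fun j hj x hx => by
    have := ht j (Finset.mem_range.2 (by omega)) x hx
    simpa [h0] using this
  nlinarith [mul_nonneg hε.le (sq_nonneg t)]

/-! ### The conformal group -/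

/-- `Φ ∈ Conf(B⁴; S³)`: `Φ` restricts to a diffeomorphism of the closed ball (smooth up to the
boundary) which maps the boundary to itself and is conformal for `dx²`. -/
def IsConformalDiffeo (Φ : E4 → E4) : Prop :=
  ContDiffOn ℝ ∞ Φ B4 ∧
  (∃ Ψ : E4 → E4, ContDiffOn ℝ ∞ Ψ B4 ∧ MapsTo Ψ B4 B4 ∧
    LeftInvOn Ψ Φ B4 ∧ RightInvOn Ψ Φ B4) ∧
  MapsTo Φ B4 B4 ∧ Φ '' S3 = S3 ∧
  ∀ x ∈ B4, ∃ c : ℝ, 0 < c ∧ ∀ v w : E4,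
    inner ℝ (fderivWithin ℝ Φ B4 x v) (fderivWithin ℝ Φ B4 x w) = c * inner ℝ v w

/-- The pullback metric `Φ^* dx²` on the closed ball. -/
def pullbackFlat (Φ : E4 → E4) : Metric4 := fun x i j =>
  inner ℝ (fderivWithin ℝ Φ B4 x (EuclideanSpace.single i 1))
    (fderivWithin ℝ Φ B4 x (EuclideanSpace.single j 1))

end

end BallConformal

/-!
The theorem is a rigidity statement in the manner of Hersch: the second variation is tested on the
components of a well chosen Möbius map.

Integration by parts turns `ℱ₂` into an explicit quartic polynomial in `u` (`F2_eq`); this rests on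
the conformal transformation formulas, on `2 σ₂ dvol` being a divergence (`div_sigmaField`), and on
the divergence theorems on `B⁴` and `S³`. In particular the total curvature `∫ σ₂ + ∮ H₂` always
equals `ω₃` (`total_curvature`), so `𝒢₂` is invariant under adding constants, and a minimizer of
`ℱ₂` on `𝒱` minimizes `𝒢₂` to second order along all lines (`isAffineMin_of_F2`). Along a line
`u + t v` the second variation of `ℱ₂` is
`D_u(v) = ∫ T(∇v, ∇v) + ∮ (1 + u_r) |∇̄v|²`, with `T` the Newton tensor of `e^{2u} dx²`, and at a
minimizer, for `v` with `∮ v e^{3u} = 0`,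
`D_u(v) ≥ 3 ω₃ ∮ v² e^{3u} / ∮ e^{3u}` (`secondVariation_ge`).

Conformal barycenters give a Möbius map `φ` of the ball whose four components are balanced in this
sense (`exists_conformal_barycenter`). Write `φ^* dx² = e^{2w} dx²`. Since `∑ φₖ² = 1` on `S³`, the
four inequalities add up to `∑ D_u(φₖ) ≥ 3 ω₃`. On the other hand `∑ₖ dφₖ ⊗ dφₖ = e^{2w} dx²`, so
that only the trace of `T` enters the sum, and the flatness of `e^{2w} dx²` (`Δw = -|∇w|²`, and
`1 + w_r = e^w` on `S³`) with one more integration by parts gives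
`∑ D_u(φₖ) = 3 (ω₃ - ∫ e^{2w} |∇(u - w)|²)`
(`MobExtension.sum_secondVariation`, `MobExtension.integral_newton_trace`). Hence `u - w` is
constant (`eq_mobLog_add_const`).

The divergence theorem on the ball is derived from integration by parts on `ℝ⁴` against radial test
functions and integration in polar coordinates (`integral_ball_pd`).
-/

namespace BallConformal

noncomputable section

/-! ### Integration over `B⁴` and `S³`, and the divergence theorem -/

instance : IsFiniteMeasure surf := by unfold surf; infer_instance

theorem finrank_E4 : Module.finrank ℝ E4 = 4 := by simp

theorem omega3_pos : 0 < omega3 := by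
  unfold omega3 surf
  have : (volume : Measure E4).toSphere ≠ 0 := Measure.toSphere_ne_zero _
  rw [Measure.real, ENNReal.toReal_pos_iff]
  exact ⟨Measure.measure_univ_pos.2 this, measure_lt_top _ _⟩

/-- Integration in polar coordinates. -/
theorem integral_polar {f : E4 → ℝ} (hf : Integrable f) :
    ∫ x, f x = ∫ r in Ioi (0 : ℝ), r ^ 3 * ∫ ξ : S3, f (r • (ξ : E4)) ∂surf := by
  have mp := (volume : Measure E4).measurePreserving_homeomorphUnitSphereProd
  have emb := (homeomorphUnitSphereProd E4).measurableEmbedding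
  have hcomp : ∀ x : ({0}ᶜ : Set E4),
      (fun p : S3 × Ioi (0 : ℝ) => f ((p.2 : ℝ) • (p.1 : E4))) (homeomorphUnitSphereProd E4 x)
        = f x := by
    intro x
    have : ((homeomorphUnitSphereProd E4).symm (homeomorphUnitSphereProd E4 x) : E4) = x := by
      simp
    rw [homeomorphUnitSphereProd_symm_apply_coe] at this
    simp only [this]
  have h1 : ∫ x, f x = ∫ x : ({0}ᶜ : Set E4), f x ∂((volume : Measure E4).comap (↑)) := by
    rw [integral_subtype_comap (measurableSet_singleton _).compl f,
      restrict_compl_singleton]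
  have h2 : ∫ x : ({0}ᶜ : Set E4), f x ∂((volume : Measure E4).comap (↑)) =
      ∫ p : S3 × Ioi (0 : ℝ), f ((p.2 : ℝ) • (p.1 : E4))
        ∂(surf.prod (.volumeIoiPow 3)) := by
    have := mp.integral_comp emb (fun p : S3 × Ioi (0 : ℝ) => f ((p.2 : ℝ) • (p.1 : E4)))
    simp only [hcomp] at this
    rw [this, finrank_E4]; rfl
  have hint : Integrable (fun p : S3 × Ioi (0 : ℝ) => f ((p.2 : ℝ) • (p.1 : E4)))
      (surf.prod (.volumeIoiPow 3)) := by
    have h3 := mp.integrable_comp_emb emb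
      (g := fun p : S3 × Ioi (0 : ℝ) => f ((p.2 : ℝ) • (p.1 : E4)))
    rw [finrank_E4] at h3
    refine h3.1 ?_
    have : ((fun p : S3 × Ioi (0 : ℝ) => f ((p.2 : ℝ) • (p.1 : E4))) ∘
      (homeomorphUnitSphereProd E4)) = fun x : ({0}ᶜ : Set E4) => f x := funext hcomp
    rw [this]
    exact (integrableOn_iff_comap_subtypeVal (measurableSet_singleton _).compl).1 hf.integrableOn
  rw [h1, h2, integral_prod_symm _ hint]
  simp only [Measure.volumeIoiPow, ENNReal.ofReal]
  rw [integral_withDensity_eq_integral_smul]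
  · rw [integral_subtype_comap measurableSet_Ioi
      fun r : ℝ ↦ Real.toNNReal (r ^ 3) • ∫ ξ : S3, f (r • (ξ : E4)) ∂surf]
    refine setIntegral_congr_fun measurableSet_Ioi fun r hr => ?_
    simp only [NNReal.smul_def, Real.coe_toNNReal _ (pow_nonneg (le_of_lt hr) 3), smul_eq_mul]
  · exact (measurable_subtype_coe.pow_const _).real_toNNReal

/-- Differentiation under an integral over the compact sphere. -/
theorem hasFDerivAt_integral_sphere {H : Type*} [NormedAddCommGroup H] [NormedSpace ℝ H]
    {F : H → E4 → ℝ} {F' : H → E4 → H →L[ℝ] ℝ} {U : Set H} (hU : IsOpen U)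
    (hF : ∀ b ∈ U, ContinuousOn (F b) S3)
    (hd : ∀ b ∈ U, ∀ ξ ∈ S3, HasFDerivAt (fun b => F b ξ) (F' b ξ) b)
    (hc : ∀ b ∈ U, ∀ ξ ∈ S3, ContinuousAt (fun p : H × E4 => F' p.1 p.2) (b, ξ))
    (ν : Measure S3) [IsFiniteMeasure ν] {a : H} (ha : a ∈ U) :
    HasFDerivAt (fun b => ∫ ξ : S3, F b ξ ∂ν) (∫ ξ : S3, F' a ξ ∂ν) a := by
  have hcS : Continuous fun ξ : S3 => F' a ξ := by
    rw [continuous_iff_continuousAt]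
    intro ξ
    exact ContinuousAt.comp (f := fun ξ : S3 => (a, (ξ : E4))) (hc a ha ξ ξ.2)
      (by fun_prop)
  have hFS : ∀ b ∈ U, Continuous fun ξ : S3 => F b ξ := fun b hb =>
    continuousOn_iff_continuous_domRestrict.1 (hF b hb)
  have hS3 : IsCompact S3 := isCompact_sphere _ _
  obtain ⟨C, hC⟩ := (isCompact_range hcS).isBounded.exists_norm_le
  have hev : ∀ᶠ b in 𝓝 a, ∀ ξ ∈ S3, ‖F' b ξ‖ < C + 1 := by
    refine hS3.eventually_forall_of_forall_eventually fun ξ hξ => ?_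
    have h1 : ‖F' a ξ‖ < C + 1 := by
      have := hC _ (mem_range_self (⟨ξ, hξ⟩ : S3)); simp only at this; linarith
    exact (hc a ha ξ hξ).norm.eventually (gt_mem_nhds h1)
  have hUn := hU.mem_nhds ha
  refine hasFDerivAt_integral_of_dominated_of_fderiv_le (F := fun b (ξ : S3) => F b ξ)
    (F' := fun b (ξ : S3) => F' b ξ) (bound := fun _ => C + 1) (inter_mem hUn hev)
    ?_ ?_ ?_ ?_ (integrable_const _) ?_
  · filter_upwards [hUn] with b hb
    exact (hFS b hb).aestronglyMeasurable
  · exact (hFS a ha).integrable_of_hasCompactSupport (HasCompactSupport.of_compactSpace _)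
  · exact hcS.aestronglyMeasurable
  · exact ae_of_all _ fun ξ b hb => (hb.2 ξ ξ.2).le
  · exact ae_of_all _ fun ξ b hb => hd b hb.1 ξ ξ.2

theorem integrable_fun_sub {α : Type*} {m : MeasurableSpace α} {μ : Measure α} {f g : α → ℝ}
    (hf : Integrable f μ) (hg : Integrable g μ) : Integrable (fun x => f x - g x) μ :=
  hf.sub hg

theorem integrable_surf {f : E4 → ℝ} (hf : Continuous f) :
    Integrable (fun ξ : S3 => f ξ) surf :=
  (hf.comp continuous_subtype_val).integrable_of_hasCompactSupport
    (HasCompactSupport.of_compactSpace _)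

theorem continuous_integral_sphere {F : ℝ → E4 → ℝ}
    (hF : Continuous fun p : ℝ × E4 => F p.1 p.2) :
    Continuous fun r => ∫ ξ : S3, F r ξ ∂surf := by
  have := continuous_parametric_integral_of_continuous (μ := surf)
    (f := fun (r : ℝ) (ξ : S3) => F r ξ) (s := univ)
    (by change Continuous fun p : ℝ × S3 => F p.1 p.2
        exact hF.comp (f := fun p : ℝ × S3 => (p.1, (p.2 : E4))) (by fun_prop)) isCompact_univ
  simpa using this

theorem pd_contDiff {f : E4 → ℝ} (hf : ContDiff ℝ ∞ f) (i : Fin 4) : ContDiff ℝ ∞ (pd i f) :=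
  (hf.fderiv_right (m := ∞) (by simp)).clm_apply contDiff_const

theorem fderiv_eq_sum_pd (f : E4 → ℝ) (x v : E4) : fderiv ℝ f x v = ∑ i, v i * pd i f x := by
  have hv : v = ∑ i, v i • EuclideanSpace.single i (1 : ℝ) := by
    ext j; simp [Finset.sum_apply, Pi.single_apply]
  conv_lhs => rw [hv]
  simp [pd]

theorem integrable_ball {f : E4 → ℝ} (hf : Continuous f) : IntegrableOn f B4 :=
  hf.continuousOn.integrableOn_compact (isCompact_closedBall _ _)

/-- The integral over the ball in polar coordinates. -/
theorem integral_ball_polar {f : E4 → ℝ} (hf : Continuous f) :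
    ∫ x in B4, f x = ∫ r in (0 : ℝ)..1, r ^ 3 * ∫ ξ : S3, f (r • (ξ : E4)) ∂surf := by
  have hm : MeasurableSet B4 := measurableSet_closedBall
  rw [← integral_indicator hm,
    integral_polar ((integrable_indicator_iff hm).2 (integrable_ball hf)),
    intervalIntegral.integral_of_le zero_le_one]
  have : ∀ r ∈ Ioi (0 : ℝ), r ^ 3 * ∫ ξ : S3, B4.indicator f (r • (ξ : E4)) ∂surf =
      (Iic (1 : ℝ)).indicator (fun r => r ^ 3 * ∫ ξ : S3, f (r • (ξ : E4)) ∂surf) r := by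
    intro r hr
    have hmem : ∀ ξ : S3, r • (ξ : E4) ∈ B4 ↔ r ∈ Iic (1 : ℝ) := by
      intro ξ
      have : ‖(ξ : E4)‖ = 1 := by simp
      simp [norm_smul, this, abs_of_pos (show 0 < r from hr)]
    by_cases h : r ∈ Iic (1 : ℝ)
    · simp only [indicator_of_mem h, indicator_of_mem ((hmem _).2 h)]
    · simp only [indicator_of_notMem h, indicator_of_notMem (fun h' => h ((hmem _).1 h'))]
      simp
  rw [setIntegral_congr_fun measurableSet_Ioi this, setIntegral_indicator measurableSet_Iic,
    Ioi_inter_Iic]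

theorem hasDerivAt_integral_sphere {F F' : ℝ → E4 → ℝ} (hF : ∀ r, Continuous (F r))
    (hd : ∀ r ξ, HasDerivAt (fun r => F r ξ) (F' r ξ) r)
    (hc : Continuous fun p : ℝ × E4 => F' p.1 p.2) (r : ℝ) :
    HasDerivAt (fun r : ℝ => ∫ ξ : S3, F r ξ ∂surf) (∫ ξ : S3, F' r ξ ∂surf) r := by
  have h := hasFDerivAt_integral_sphere (F := F)
    (F' := fun (r : ℝ) ξ => ContinuousLinearMap.toSpanSingleton ℝ (F' r ξ))
    (U := univ) isOpen_univ (fun b _ => (hF b).continuousOn) (fun b _ ξ _ => (hd b ξ).hasFDerivAt)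
    (fun b _ ξ _ => ((ContinuousLinearMap.toSpanSingletonCLE (𝕜 := ℝ) (E := ℝ)).continuous.comp
      hc).continuousAt) surf (mem_univ r)
  have h2 := h.hasDerivAt
  have hint : Integrable (fun ξ : S3 => ContinuousLinearMap.toSpanSingleton ℝ (F' r ξ)) surf :=
    (((ContinuousLinearMap.toSpanSingletonCLE (𝕜 := ℝ) (E := ℝ)).continuous.comp hc).comp
      (f := fun ξ : S3 => (r, (ξ : E4))) (by fun_prop)).integrable_of_hasCompactSupport
      (HasCompactSupport.of_compactSpace _)
  rw [ContinuousLinearMap.integral_apply hint] at h2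
  simpa using h2

/-- The radial derivative of a spherical mean. -/
theorem hasDerivAt_sphere_dilate {f : E4 → ℝ} (hf : ContDiff ℝ ∞ f) (r : ℝ) :
    HasDerivAt (fun r : ℝ => ∫ ξ : S3, f (r • (ξ : E4)) ∂surf)
      (∫ ξ : S3, fderiv ℝ f (r • (ξ : E4)) ξ ∂surf) r := by
  refine hasDerivAt_integral_sphere (F := fun r ξ => f (r • ξ))
    (F' := fun r ξ => fderiv ℝ f (r • ξ) ξ) (fun b => hf.continuous.comp (by fun_prop))
    (fun r ξ => ?_) (((hf.continuous_fderiv (by simp)).comp (by fun_prop)).clm_apply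
      continuous_snd) r
  have h1 : HasDerivAt (fun r : ℝ => r • ξ) ξ r := by
    simpa using (hasDerivAt_id r).smul_const ξ
  exact ((hf.differentiable (by simp)).differentiableAt.hasFDerivAt).comp_hasDerivAt r h1

/-- The divergence theorem tested against `x ↦ η |x|`, with `η` supported in `(0, ∞)`: in the
sense of distributions, `r³ ∮ f(rξ) ξᵢ` has the derivative `r³ ∮ ∂ᵢf(rξ)` in `r`. -/
theorem integral_test_mul_pd {f : E4 → ℝ} (hf : ContDiff ℝ ∞ f) (i : Fin 4) {η : ℝ → ℝ}
    (hη : ContDiff ℝ ∞ η) (hc : HasCompactSupport η) (hs : tsupport η ⊆ Ioi 0) :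
    ∫ r in Ioi (0 : ℝ), η r * (r ^ 3 * ∫ ξ : S3, pd i f (r • (ξ : E4)) ∂surf) =
      -∫ r in Ioi (0 : ℝ), deriv η r * (r ^ 3 * ∫ ξ : S3, f (r • (ξ : E4)) * (ξ : E4) i ∂surf) := by
  set G : E4 → ℝ := fun x => η ‖x‖ with hG
  have hGsupp : Function.support G ⊆ norm ⁻¹' tsupport η := fun x hx => subset_tsupport η hx
  have hcl : IsClosed (norm ⁻¹' tsupport η : Set E4) :=
    (isClosed_tsupport η).preimage continuous_norm
  have htG : tsupport G ⊆ norm ⁻¹' tsupport η := closure_minimal hGsupp hcl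
  have hGc : HasCompactSupport G := by
    obtain ⟨R, hR⟩ := hc.isCompact.isBounded.exists_norm_le
    refine HasCompactSupport.intro (isCompact_closedBall (0 : E4) R) fun x hx => ?_
    by_contra hne
    exact hx (by simpa using hR _ (hGsupp hne))
  have hG0 : ∀ x : E4, x ≠ 0 → ContDiffAt ℝ ∞ G x := fun x hx =>
    hη.contDiffAt.comp x (contDiffAt_norm ℝ hx)
  have hGsm : ContDiff ℝ ∞ G := by
    rw [contDiff_iff_contDiffAt]
    intro x
    by_cases hx : x = 0
    · have : x ∉ tsupport G := fun h => by
        have := hs (htG h); simp [hx] at this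
      exact contDiffAt_const.congr_of_eventuallyEq (notMem_tsupport_iff_eventuallyEq.1 this)
    · exact hG0 x hx
  have hGd : ∀ (r : ℝ) (ξ : S3), 0 < r →
      fderiv ℝ G (r • (ξ : E4)) (EuclideanSpace.single i 1) = deriv η r * (ξ : E4) i := by
    intro r ξ hr
    have hξ : ‖(ξ : E4)‖ = 1 := by simp
    have hne : r • (ξ : E4) ≠ 0 := by
      rw [← norm_pos_iff, norm_smul, hξ]; simpa using hr.ne'
    have hn : ‖r • (ξ : E4)‖ = r := by rw [norm_smul, hξ]; simp [abs_of_pos hr]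
    have hsq : HasFDerivAt (fun x : E4 => ‖x‖ ^ 2) (2 • innerSL ℝ (r • (ξ : E4))) (r • (ξ : E4)) :=
      (hasStrictFDerivAt_norm_sq _).hasFDerivAt
    have h1 := hsq.sqrt (by rw [hn]; positivity)
    have h2 : (fun x : E4 => √(‖x‖ ^ 2)) = fun x => ‖x‖ := by
      ext x; exact Real.sqrt_sq (norm_nonneg x)
    rw [h2, hn, Real.sqrt_sq hr.le] at h1
    have hηd : HasDerivAt η (deriv η r) ‖r • (ξ : E4)‖ := by
      rw [hn]; exact ((hη.differentiable (by simp)) r).hasDerivAt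
    have h3 := hηd.comp_hasFDerivAt _ h1
    have h4 : HasFDerivAt G _ (r • (ξ : E4)) := h3
    rw [h4.fderiv]
    simp [EuclideanSpace.inner_single_right]
    field_simp
    simp
  have hdG : Continuous fun x => fderiv ℝ G x (EuclideanSpace.single i 1) :=
    (pd_contDiff hGsm i).continuous
  have hpf := (pd_contDiff hf i).continuous
  have hdGc : HasCompactSupport fun x => fderiv ℝ G x (EuclideanSpace.single i 1) :=
    hGc.fderiv_apply ℝ _
  have ibp := integral_mul_fderiv_eq_neg_fderiv_mul_of_integrable (μ := (volume : Measure E4))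
    (f := G) (g := f) (v := EuclideanSpace.single i 1)
    ((hdG.mul hf.continuous).integrable_of_hasCompactSupport hdGc.mul_right)
    ((hGsm.continuous.mul hpf).integrable_of_hasCompactSupport hGc.mul_right)
    ((hGsm.continuous.mul hf.continuous).integrable_of_hasCompactSupport hGc.mul_right)
    (fun x _ => hGsm.differentiable (by simp) x) (fun x _ => hf.differentiable (by simp) x)
  rw [integral_polar
      (f := fun x => G x * fderiv ℝ f x (EuclideanSpace.single i 1))
      ((hGsm.continuous.mul hpf).integrable_of_hasCompactSupport hGc.mul_right),
    integral_polar (f := fun x => fderiv ℝ G x (EuclideanSpace.single i 1) * f x)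
      ((hdG.mul hf.continuous).integrable_of_hasCompactSupport hdGc.mul_right)] at ibp
  have l1 : ∀ r ∈ Ioi (0 : ℝ), r ^ 3 * ∫ ξ : S3, G (r • (ξ : E4)) *
      fderiv ℝ f (r • (ξ : E4)) (EuclideanSpace.single i 1) ∂surf =
      η r * (r ^ 3 * ∫ ξ : S3, pd i f (r • (ξ : E4)) ∂surf) := by
    intro r hr
    have : ∀ ξ : S3, G (r • (ξ : E4)) = η r := fun ξ => by
      simp [hG, norm_smul, abs_of_pos (show 0 < r from hr)]
    simp only [this, integral_const_mul]
    simp only [pd]; ring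
  have l2 : ∀ r ∈ Ioi (0 : ℝ), r ^ 3 * ∫ ξ : S3,
      fderiv ℝ G (r • (ξ : E4)) (EuclideanSpace.single i 1) * f (r • (ξ : E4)) ∂surf =
      deriv η r * (r ^ 3 * ∫ ξ : S3, f (r • (ξ : E4)) * (ξ : E4) i ∂surf) := by
    intro r hr
    simp only [hGd r _ hr]
    rw [← integral_const_mul, ← integral_const_mul, ← integral_const_mul]
    congr 1; ext ξ; ring
  rw [← setIntegral_congr_fun measurableSet_Ioi l1, ← setIntegral_congr_fun measurableSet_Ioi l2]
  exact ibp

/-- The divergence theorem on the ball, for one component. By `integral_test_mul_pd` and the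
fundamental lemma of the calculus of variations, the derivative of `r³ ∮ f(rξ) ξᵢ` is
`r³ ∮ ∂ᵢf(rξ)`; it remains to integrate over `0 < r < 1`. -/
theorem integral_ball_pd {f : E4 → ℝ} (hf : ContDiff ℝ ∞ f) (i : Fin 4) :
    ∫ x in B4, pd i f x = ∫ ξ : S3, f ξ * (ξ : E4) i ∂surf := by
  have hpf := pd_contDiff hf i
  set k : ℝ → ℝ := fun r => r ^ 3 * ∫ ξ : S3, pd i f (r • (ξ : E4)) ∂surf with hk
  set h : ℝ → ℝ := fun r => ∫ ξ : S3, f (r • (ξ : E4)) * (r • (ξ : E4)) i ∂surf with hh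
  set h' : ℝ → ℝ := fun r =>
    ∫ ξ : S3, fderiv ℝ (fun x => f x * x i) (r • (ξ : E4)) ξ ∂surf with hh'
  have hg : ContDiff ℝ ∞ (fun x : E4 => f x * x i) := by fun_prop
  have hder : ∀ r, HasDerivAt h (h' r) r := fun r => hasDerivAt_sphere_dilate hg r
  have hkc : Continuous k := (continuous_id.pow 3).mul
    (continuous_integral_sphere (F := fun r ξ => pd i f (r • ξ))
      (hpf.continuous.comp (by fun_prop)))
  have hc' : Continuous h' := continuous_integral_sphere
    (F := fun r ξ => fderiv ℝ (fun x : E4 => f x * x i) (r • ξ) ξ)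
    (((hg.continuous_fderiv (by simp)).comp (by fun_prop)).clm_apply continuous_snd)
  have hc : Continuous h := continuous_iff_continuousAt.2 fun r => (hder r).continuousAt
  -- `H r = r³ ∮ f(rξ) ξᵢ = r² h r`, whose derivative has to be `k`
  have hH : ∀ r, r ^ 3 * ∫ ξ : S3, f (r • (ξ : E4)) * (ξ : E4) i ∂surf = r ^ 2 * h r := by
    intro r
    rw [← integral_const_mul, hh, ← integral_const_mul]
    congr 1; ext ξ; simp; ring
  set H' : ℝ → ℝ := fun r => 2 * r * h r + r ^ 2 * h' r with hH'
  have hHd : ∀ r, HasDerivAt (fun r => r ^ 2 * h r) (H' r) r := fun r => by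
    have := (hasDerivAt_pow 2 r).mul (hder r)
    simp only [Nat.cast_ofNat, Nat.add_one_sub_one, pow_one] at this
    exact this
  have hH'c : Continuous H' := by fun_prop
  have hae : ∀ᵐ r, r ∈ Ioi (0 : ℝ) → k r - H' r = 0 := by
    refine IsOpen.ae_eq_zero_of_integral_contDiff_smul_eq_zero isOpen_Ioi
      ((hkc.sub hH'c).locallyIntegrable.locallyIntegrableOn _) fun η hη hcη hs => ?_
    have h1 := integral_test_mul_pd hf i hη hcη hs
    have hz : ∀ φ : ℝ → ℝ, ∀ r, r ∉ Ioi (0 : ℝ) → η r * φ r = 0 := fun φ r hr => by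
      rw [image_eq_zero_of_notMem_tsupport (fun h => hr (hs h)), zero_mul]
    have hz' : ∀ φ : ℝ → ℝ, ∀ r, r ∉ Ioi (0 : ℝ) → deriv η r * φ r = 0 := fun φ r hr => by
      rw [image_eq_zero_of_notMem_tsupport (fun h => hr (hs (tsupport_deriv_subset h))),
        zero_mul]
    simp only [hH] at h1
    rw [setIntegral_eq_integral_of_forall_compl_eq_zero (hz k),
      setIntegral_eq_integral_of_forall_compl_eq_zero (hz' _)] at h1
    have hηd : Continuous (deriv η) := hη.continuous_deriv (by simp)
    have hHc : Continuous fun r => r ^ 2 * h r := by fun_prop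
    have ibp := integral_mul_deriv_eq_deriv_mul_of_integrable (u := η) (u' := deriv η)
      (v := fun r => r ^ 2 * h r) (v' := H')
      (fun r _ => ((hη.differentiable (by simp)) r).hasDerivAt) (fun r _ => hHd r)
      ((hη.continuous.mul hH'c).integrable_of_hasCompactSupport hcη.mul_right)
      ((hηd.mul hHc).integrable_of_hasCompactSupport hcη.deriv.mul_right)
      ((hη.continuous.mul hHc).integrable_of_hasCompactSupport hcη.mul_right)
    rw [← ibp] at h1
    simp only [smul_eq_mul, mul_sub]
    rw [integral_sub (f := fun x => η x * k x) (g := fun x => η x * H' x)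
      ((hη.continuous.mul hkc).integrable_of_hasCompactSupport hcη.mul_right)
      ((hη.continuous.mul hH'c).integrable_of_hasCompactSupport hcη.mul_right), h1, sub_self]
  rw [integral_ball_polar hpf.continuous]
  have e1 : ∫ r in (0 : ℝ)..1, k r = ∫ r in (0 : ℝ)..1, H' r := by
    refine intervalIntegral.integral_congr_ae ?_
    filter_upwards [hae] with r hr hr'
    rw [uIoc_of_le zero_le_one] at hr'
    exact sub_eq_zero.1 (hr hr'.1)
  rw [show (∫ r in (0 : ℝ)..1, r ^ 3 * ∫ ξ : S3, pd i f (r • (ξ : E4)) ∂surf) =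
    ∫ r in (0 : ℝ)..1, k r from rfl, e1,
    intervalIntegral.integral_eq_sub_of_hasDerivAt (fun r _ => hHd r)
      (hH'c.intervalIntegrable _ _)]
  simp [hh]

/-! ### Curvatures of `e^{2u} dx²` -/

theorem cd_at {f : E4 → ℝ} (hf : ContDiff ℝ ∞ f) (x : E4) : DifferentiableAt ℝ f x :=
  hf.differentiable (by simp) x

theorem pd_add {f g : E4 → ℝ} {x : E4} (hf : DifferentiableAt ℝ f x)
    (hg : DifferentiableAt ℝ g x) (i : Fin 4) :
    pd i (fun y => f y + g y) x = pd i f x + pd i g x := by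
  simp [pd, fderiv_fun_add hf hg]

theorem pd_sub {f g : E4 → ℝ} {x : E4} (hf : DifferentiableAt ℝ f x)
    (hg : DifferentiableAt ℝ g x) (i : Fin 4) :
    pd i (fun y => f y - g y) x = pd i f x - pd i g x := by
  simp [pd, fderiv_fun_sub hf hg]

theorem pd_mul {f g : E4 → ℝ} {x : E4} (hf : DifferentiableAt ℝ f x)
    (hg : DifferentiableAt ℝ g x) (i : Fin 4) :
    pd i (fun y => f y * g y) x = pd i f x * g x + f x * pd i g x := by
  simp [pd, fderiv_fun_mul hf hg]; ring

theorem pd_const_mul {f : E4 → ℝ} {x : E4} (c : ℝ) (i : Fin 4) :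
    pd i (fun y => c * f y) x = c * pd i f x := by
  have : (fun y => c * f y) = c • f := rfl
  rw [pd, this, fderiv_const_smul_field]; rfl

theorem pd_const (c : ℝ) (x : E4) (i : Fin 4) : pd i (fun _ => c) x = 0 := by
  simp [pd]

theorem pd_sum {ι : Type*} (s : Finset ι) {f : ι → E4 → ℝ} {x : E4}
    (hf : ∀ k ∈ s, DifferentiableAt ℝ (f k) x) (i : Fin 4) :
    pd i (fun y => ∑ k ∈ s, f k y) x = ∑ k ∈ s, pd i (f k) x := by
  simp [pd, fderiv_fun_sum hf]

theorem pd_coord (i j : Fin 4) (x : E4) :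
    pd i (fun y => y j) x = if i = j then 1 else 0 := by
  have h : HasFDerivAt (fun y : E4 => y j) (EuclideanSpace.proj j : E4 →L[ℝ] ℝ) x :=
    (EuclideanSpace.proj j : E4 →L[ℝ] ℝ).hasFDerivAt
  rw [pd, h.fderiv]
  simp [eq_comm]

theorem pd_comp {φ : ℝ → ℝ} {φ' : ℝ} {f : E4 → ℝ} {x : E4} (hφ : HasDerivAt φ φ' (f x))
    (hf : DifferentiableAt ℝ f x) (i : Fin 4) :
    pd i (fun y => φ (f y)) x = φ' * pd i f x := by
  have h : HasFDerivAt (fun y => φ (f y)) _ x := hφ.comp_hasFDerivAt x hf.hasFDerivAt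
  rw [pd, h.fderiv]
  simp [pd]

theorem pd_comm {u : E4 → ℝ} (hu : ContDiff ℝ ∞ u) (i j : Fin 4) (x : E4) :
    pd i (pd j u) x = pd j (pd i u) x := by
  have hsym : IsSymmSndFDerivAt ℝ u x := 
    hu.contDiffAt.isSymmSndFDerivAt (by simp; exact WithTop.coe_le_coe.2 (le_top : (2 : ℕ∞) ≤ ⊤))
  have hd : DifferentiableAt ℝ (fderiv ℝ u) x :=
    (hu.fderiv_right (m := ∞) (by simp)).differentiable (by simp) x
  have key : ∀ i j, pd i (pd j u) x =
      fderiv ℝ (fderiv ℝ u) x (EuclideanSpace.single i 1) (EuclideanSpace.single j 1) := by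
    intro i j
    have h1 : pd j u = fun y => fderiv ℝ u y (EuclideanSpace.single j 1) := rfl
    rw [pd, h1, fderiv_clm_apply hd (differentiableAt_const _)]
    simp
  rw [key, key]
  exact hsym _ _

/-- The flat inner product `⟨∇u, ∇v⟩`. -/
def gdot (u v : E4 → ℝ) (x : E4) : ℝ := ∑ i, pd i u x * pd i v x

/-- The flat Laplacian (the trace of the Hessian). -/
def lap (u : E4 → ℝ) (x : E4) : ℝ := ∑ i, pd i (pd i u) x

/-- The radial derivative `u_r = x · ∇u`, on `S³` the normal derivative. -/
def rad (u : E4 → ℝ) (x : E4) : ℝ := ∑ i, x i * pd i u x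

/-- The Hessian evaluated on two gradients, `∇²u(∇v, ∇w)`. -/
def hess (u v w : E4 → ℝ) (x : E4) : ℝ := ∑ i, ∑ j, pd i (pd j u) x * pd i v x * pd j w x

/-- The Hessian evaluated on the position vector, `∇²u(x, x)`. -/
def radHess (u : E4 → ℝ) (x : E4) : ℝ := ∑ i, ∑ j, pd i (pd j u) x * x i * x j

/-- The Schouten tensor of `e^{2u} dx²`: `-∇²u + du ⊗ du - ½ |du|² dx²`. -/
def schoutenFlat (u : E4 → ℝ) (i j : Fin 4) (x : E4) : ℝ :=
  -pd i (pd j u) x + pd i u x * pd j u x - if i = j then gdot u u x / 2 else 0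

/-- The density `σ₂ dvol` of `e^{2u} dx²` with respect to Lebesgue measure. -/
def sigmaDens (u : E4 → ℝ) (x : E4) : ℝ :=
  (1 / 2) * ((∑ i, schoutenFlat u i i x) ^ 2 - ∑ i, ∑ j, schoutenFlat u i j x ^ 2)

/-- The density `H₂ dvol` of `e^{2u} dx²` on `S³` with respect to the standard surface measure. -/
def bdryH2Dens (u : E4 → ℝ) (x : E4) : ℝ :=
  (1 + rad u x) * ((∑ i, schoutenFlat u i i x) - ∑ i, ∑ j, schoutenFlat u i j x * x i * x j)
    + (1 + rad u x) ^ 3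

theorem conf_apply (u : E4 → ℝ) (x : E4) (i j : Fin 4) :
    conf u x i j = if i = j then Real.exp (2 * u x) else 0 := by
  simp [conf, Matrix.one_apply]

theorem conf_inv (u : E4 → ℝ) (x : E4) :
    (conf u x)⁻¹ = Real.exp (-(2 * u x)) • (1 : Matrix (Fin 4) (Fin 4) ℝ) := by
  apply Matrix.inv_eq_right_inv
  simp only [conf, smul_mul_smul_comm, ← Real.exp_add, mul_one]
  simp

theorem conf_inv_apply (u : E4 → ℝ) (x : E4) (i j : Fin 4) :
    (conf u x)⁻¹ i j = if i = j then Real.exp (-(2 * u x)) else 0 := by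
  simp [conf_inv, Matrix.one_apply]

theorem conf_det (u : E4 → ℝ) (x : E4) : (conf u x).det = Real.exp (8 * u x) := by
  simp only [conf, Matrix.det_smul, Fintype.card_fin, Matrix.det_one, mul_one, ← Real.exp_nat_mul]
  congr 1; push_cast; ring

theorem volDens_conf (u : E4 → ℝ) (x : E4) : volDens (conf u) x = Real.exp (4 * u x) := by
  rw [volDens, conf_det, show 8 * u x = 4 * u x + 4 * u x by ring, Real.exp_add,
    Real.sqrt_mul_self (Real.exp_pos _).le]

theorem pd_conf {u : E4 → ℝ} (hu : ContDiff ℝ ∞ u) (x : E4) (k i j : Fin 4) :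
    pd k (fun y => conf u y i j) x =
      if i = j then 2 * pd k u x * Real.exp (2 * u x) else 0 := by
  simp only [conf_apply]
  by_cases h : i = j
  · simp only [h, if_true]
    rw [pd_comp (φ := Real.exp) (f := fun y => 2 * u y) (Real.hasDerivAt_exp _)
      ((cd_at hu x).const_mul 2), pd_const_mul]
    ring
  · simp only [h, if_false, pd_const]

theorem christoffel_conf {u : E4 → ℝ} (hu : ContDiff ℝ ∞ u) (k i j : Fin 4) :
    christoffel (conf u) k i j = fun x => (if j = k then pd i u x else 0)
      + (if i = k then pd j u x else 0) - if i = j then pd k u x else 0 := by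
  ext x
  have he : Real.exp (-(2 * u x)) * Real.exp (2 * u x) = 1 := by rw [← Real.exp_add]; simp
  simp only [christoffel, conf_inv_apply, pd_conf hu, ite_mul, zero_mul, Finset.sum_ite_eq,
    Finset.mem_univ, if_true]
  linear_combination (norm := (split_ifs <;> ring)) ((if j = k then pd i u x else 0)
      + (if i = k then pd j u x else 0) - if i = j then pd k u x else 0) * he

theorem pd_ite (c : Prop) [Decidable c] (f : E4 → ℝ) (i : Fin 4) (x : E4) :
    pd i (fun y => if c then f y else 0) x = if c then pd i f x else 0 := by
  split_ifs
  · rfl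
  · exact pd_const 0 x i

theorem pd_christoffel_conf {u : E4 → ℝ} (hu : ContDiff ℝ ∞ u) (m k i j : Fin 4) (x : E4) :
    pd m (christoffel (conf u) k i j) x = (if j = k then pd m (pd i u) x else 0)
      + (if i = k then pd m (pd j u) x else 0) - if i = j then pd m (pd k u) x else 0 := by
  have hd : ∀ (c : Prop) [Decidable c] (i : Fin 4),
      DifferentiableAt ℝ (fun y => if c then pd i u y else 0) x := by
    intro c _ i
    split_ifs
    · exact cd_at (pd_contDiff hu i) x
    · exact differentiableAt_const _
  rw [christoffel_conf hu, pd_sub ((hd _ _).fun_add (hd _ _)) (hd _ _), pd_add (hd _ _) (hd _ _)]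
  simp only [pd_ite]

theorem ricci_conf {u : E4 → ℝ} (hu : ContDiff ℝ ∞ u) (i j : Fin 4) (x : E4) :
    ricci (conf u) i j x = -2 * pd i (pd j u) x + 2 * (pd i u x * pd j u x)
      - if i = j then lap u x + 2 * gdot u u x else 0 := by
  have hc : ∀ i j, i < j → pd j (pd i u) x = pd i (pd j u) x := fun i j _ => pd_comm hu j i x
  simp only [ricci, pd_christoffel_conf hu]
  simp only [christoffel_conf hu, lap, gdot, Fin.sum_univ_four]
  fin_cases i <;> fin_cases j <;>
    simp [hc 0 1 (by decide), hc 0 2 (by decide), hc 0 3 (by decide), hc 1 2 (by decide),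
      hc 1 3 (by decide), hc 2 3 (by decide)] <;> ring

theorem scalarCurv_conf {u : E4 → ℝ} (hu : ContDiff ℝ ∞ u) (x : E4) :
    scalarCurv (conf u) x = Real.exp (-(2 * u x)) * (-6 * lap u x - 6 * gdot u u x) := by
  simp only [scalarCurv, conf_inv_apply, ricci_conf hu, ite_mul, zero_mul, Finset.sum_ite_eq,
    Finset.mem_univ, if_true]
  simp only [← Finset.mul_sum, Finset.sum_sub_distrib, Finset.sum_add_distrib]
  simp [lap, gdot]
  ring

theorem schouten_conf {u : E4 → ℝ} (hu : ContDiff ℝ ∞ u) (i j : Fin 4) (x : E4) :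
    schouten (conf u) i j x = schoutenFlat u i j x := by
  have he : Real.exp (-(2 * u x)) * Real.exp (2 * u x) = 1 := by rw [← Real.exp_add]; simp
  rw [schouten, schoutenFlat, ricci_conf hu, scalarCurv_conf hu, conf_apply]
  split_ifs
  · linear_combination (1 / 2) * (lap u x + gdot u u x) * he
  · ring

theorem sigma2_conf {u : E4 → ℝ} (hu : ContDiff ℝ ∞ u) (x : E4) :
    sigma2 (conf u) x * volDens (conf u) x = sigmaDens u x := by
  have he : Real.exp (-(2 * u x)) ^ 2 * Real.exp (4 * u x) = 1 := by
    rw [← Real.exp_nat_mul, ← Real.exp_add]; simp; ring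
  have h1 : sigma1 (conf u) x = Real.exp (-(2 * u x)) * ∑ i, schoutenFlat u i i x := by
    simp only [sigma1, conf_inv_apply, schouten_conf hu, ite_mul, zero_mul, Finset.sum_ite_eq,
      Finset.mem_univ, if_true, Finset.mul_sum]
  have h2 : schoutenNormSq (conf u) x =
      Real.exp (-(2 * u x)) ^ 2 * ∑ i, ∑ j, schoutenFlat u i j x ^ 2 := by
    simp only [schoutenNormSq, conf_inv_apply, schouten_conf hu, Finset.mul_sum]
    refine Finset.sum_congr rfl fun i _ => Finset.sum_congr rfl fun j _ => ?_
    rw [Finset.sum_eq_single i (fun k _ hk => by simp [hk.symm]) (by simp),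
      Finset.sum_eq_single j (fun k _ hk => by simp [hk.symm]) (by simp), if_pos rfl, if_pos rfl]
    ring
  rw [sigma2, h1, h2, volDens_conf, sigmaDens]
  linear_combination (1 / 2) * ((∑ i, schoutenFlat u i i x) ^ 2
    - ∑ i, ∑ j, schoutenFlat u i j x ^ 2) * he

theorem norm_sq_eq_sum (x : E4) : ‖x‖ ^ 2 = ∑ i, x i * x i := by
  rw [EuclideanSpace.norm_sq_eq]
  exact Finset.sum_congr rfl fun i _ => by rw [Real.norm_eq_abs, sq_abs, sq]

theorem conormalSq_conf (u : E4 → ℝ) (x : E4) :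
    conormalSq (conf u) x = Real.exp (-(2 * u x)) * ‖x‖ ^ 2 := by
  simp only [conormalSq, conf_inv_apply, ite_mul, zero_mul, Finset.sum_ite_eq, Finset.mem_univ,
    if_true, norm_sq_eq_sum, Finset.mul_sum, mul_assoc]

theorem bdryDens_conf (u : E4 → ℝ) {x : E4} (hx : ‖x‖ = 1) :
    bdryDens (conf u) x = Real.exp (3 * u x) := by
  rw [bdryDens, conf_det, conormalSq_conf, hx, one_pow, mul_one, ← Real.exp_add,
    show 8 * u x + -(2 * u x) = 3 * u x + 3 * u x by ring, Real.exp_add,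
    Real.sqrt_mul_self (Real.exp_pos _).le]

theorem normal_conf (u : E4 → ℝ) (i : Fin 4) :
    normal (conf u) i = fun x => Real.exp (-u x) * (x i * ‖x‖⁻¹) := by
  ext x
  have h1 : Real.sqrt (conormalSq (conf u) x) = Real.exp (-u x) * ‖x‖ := by
    rw [conormalSq_conf, show -(2 * u x) = -u x + -u x by ring, Real.exp_add, ← sq, ← mul_pow,
      Real.sqrt_sq (by positivity)]
  rw [normal, h1]
  simp only [conf_inv_apply, ite_mul, zero_mul, Finset.sum_ite_eq, Finset.mem_univ, if_true]
  rw [show -(2 * u x) = -u x + -u x by ring, Real.exp_add]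
  have := (Real.exp_pos (-u x)).ne'
  rcases eq_or_ne ‖x‖ 0 with h | h
  · simp [h]
  · field_simp

theorem pd_inv_norm {x : E4} (hx : ‖x‖ = 1) (i : Fin 4) : pd i (fun y => ‖y‖⁻¹) x = -x i := by
  have hsq : HasFDerivAt (fun x : E4 => ‖x‖ ^ 2) (2 • innerSL ℝ x) x :=
    (hasStrictFDerivAt_norm_sq x).hasFDerivAt
  have h1 := hsq.sqrt (by rw [hx]; norm_num)
  have h2 : (fun x : E4 => √(‖x‖ ^ 2)) = fun x => ‖x‖ := by
    ext x; exact Real.sqrt_sq (norm_nonneg x)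
  rw [h2, hx] at h1
  have h3 := (hasDerivAt_inv (x := ‖x‖) (by rw [hx]; norm_num)).comp_hasFDerivAt x h1
  have h4 : HasFDerivAt (fun y : E4 => ‖y‖⁻¹) _ x := h3
  rw [pd, h4.fderiv]
  simp [EuclideanSpace.inner_single_right, hx]

theorem pd_normal_conf {u : E4 → ℝ} (hu : ContDiff ℝ ∞ u) {x : E4} (hx : ‖x‖ = 1)
    (i k : Fin 4) : pd i (normal (conf u) k) x =
      Real.exp (-u x) * (-pd i u x * x k + (if i = k then 1 else 0) - x i * x k) := by
  have hx0 : x ≠ 0 := by rintro rfl; simp at hx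
  have hn : DifferentiableAt ℝ (fun y : E4 => ‖y‖⁻¹) x :=
    ((contDiffAt_norm ℝ hx0 (n := 1)).differentiableAt (by simp)).inv (by rw [hx]; norm_num)
  have hk : DifferentiableAt ℝ (fun y : E4 => y k) x := by fun_prop
  have he : DifferentiableAt ℝ (fun y : E4 => Real.exp (-u y)) x := by
    have := cd_at hu x; fun_prop
  rw [normal_conf, pd_mul he (hk.fun_mul hn), pd_mul hk hn, pd_inv_norm hx, pd_coord,
    pd_comp (φ := Real.exp) (f := fun y => -u y) (Real.hasDerivAt_exp _) (cd_at hu x).fun_neg]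
  have : pd i (fun y => -u y) x = -pd i u x := by
    have := pd_const_mul (f := u) (x := x) (-1) i
    simpa using this
  rw [this, hx]
  ring

theorem nablaNormal_conf {u : E4 → ℝ} (hu : ContDiff ℝ ∞ u) {x : E4} (hx : ‖x‖ = 1)
    (i j : Fin 4) : nablaNormal (conf u) i j x =
      Real.exp (u x) * ((if i = j then 1 + rad u x else 0) - x i * x j - pd j u x * x i) := by
  have he : Real.exp (2 * u x) * Real.exp (-u x) = Real.exp (u x) := by
    rw [← Real.exp_add]; ring_nf
  simp only [nablaNormal, conf_apply, ite_mul, zero_mul, Finset.sum_ite_eq, Finset.mem_univ,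
    if_true, pd_normal_conf hu hx]
  simp only [christoffel_conf hu, normal_conf, hx, inv_one, mul_one]
  rw [← he]
  have h2 : ∑ l, (((if l = j then pd i u x else 0) + (if i = j then pd l u x else 0))
      - if i = l then pd j u x else 0) * (Real.exp (-u x) * x l) =
      Real.exp (-u x) * (pd i u x * x j + (if i = j then rad u x else 0) - pd j u x * x i) := by
    simp only [sub_mul, add_mul, Finset.sum_sub_distrib, Finset.sum_add_distrib, ite_mul, zero_mul,
      Finset.sum_ite_eq, Finset.sum_ite_eq', Finset.mem_univ, if_true]
    split_ifs
    · have : ∑ l, pd l u x * (Real.exp (-u x) * x l) = Real.exp (-u x) * rad u x := by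
        rw [rad, Finset.mul_sum]; exact Finset.sum_congr rfl fun l _ => by ring
      rw [this]; ring
    · simp; ring
  rw [h2]
  split_ifs <;> ring

theorem tangInv_conf (u : E4 → ℝ) {x : E4} (hx : ‖x‖ = 1) (i j : Fin 4) :
    tangInv (conf u) i j x = Real.exp (-(2 * u x)) * ((if i = j then 1 else 0) - x i * x j) := by
  simp only [tangInv, conf_inv_apply, normal_conf, hx, inv_one, mul_one]
  rw [show -(2 * u x) = -u x + -u x by ring, Real.exp_add]
  split_ifs <;> ring

theorem meanCurv_conf {u : E4 → ℝ} (hu : ContDiff ℝ ∞ u) {x : E4} (hx : ‖x‖ = 1) :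
    meanCurv (conf u) x = Real.exp (-u x) * (1 + rad u x) := by
  have he : Real.exp (-(2 * u x)) * Real.exp (u x) = Real.exp (-u x) := by
    rw [← Real.exp_add]; ring_nf
  have hn : x 0 * x 0 + x 1 * x 1 + x 2 * x 2 + x 3 * x 3 = 1 := by
    have := norm_sq_eq_sum x
    rw [hx, Fin.sum_univ_four] at this; linarith
  simp only [meanCurv, tangInv_conf u hx, nablaNormal_conf hu hx, ← he]
  have : ∀ i j : Fin 4, Real.exp (-(2 * u x)) * ((if i = j then 1 else 0) - x i * x j) *
      (Real.exp (u x) * ((if i = j then 1 + rad u x else 0) - x i * x j - pd j u x * x i)) =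
      Real.exp (-(2 * u x)) * Real.exp (u x) * (((if i = j then 1 else 0) - x i * x j) *
      ((if i = j then 1 + rad u x else 0) - x i * x j - pd j u x * x i)) := fun i j => by ring
  simp only [this, ← Finset.mul_sum]
  have key : ∑ i, ∑ j, (((if i = j then 1 else 0) - x i * x j) *
      ((if i = j then 1 + rad u x else 0) - x i * x j - pd j u x * x i)) =
      3 * (1 + rad u x) := by
    simp only [rad, Fin.sum_univ_four]
    simp
    linear_combination (x 0 * x 0 + x 1 * x 1 + x 2 * x 2 + x 3 * x 3 - 1) * hn
  rw [key]
  ring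

theorem H2_conf {u : E4 → ℝ} (hu : ContDiff ℝ ∞ u) {x : E4} (hx : ‖x‖ = 1) :
    H2 (conf u) x * bdryDens (conf u) x = bdryH2Dens u x := by
  have he : Real.exp (-u x) ^ 3 * Real.exp (3 * u x) = 1 := by
    rw [← Real.exp_nat_mul, ← Real.exp_add]; simp
  have h1 : ∑ i, ∑ j, tangInv (conf u) i j x * schouten (conf u) i j x =
      Real.exp (-u x) ^ 2 *
        ((∑ i, schoutenFlat u i i x) - ∑ i, ∑ j, schoutenFlat u i j x * x i * x j) := by
    simp only [tangInv_conf u hx, schouten_conf hu]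
    rw [show -(2 * u x) = -u x + -u x by ring, Real.exp_add, ← sq]
    simp only [mul_assoc, ← Finset.mul_sum]
    simp only [sub_mul, Finset.sum_sub_distrib, ite_mul, one_mul,
      zero_mul, Finset.sum_ite_eq, Finset.mem_univ, if_true]
    congr 2
    refine Finset.sum_congr rfl fun i _ => ?_
    exact Finset.sum_congr rfl fun j _ => by ring
  rw [H2, h1, meanCurv_conf hu hx, bdryDens_conf u hx, bdryH2Dens]
  linear_combination ((1 + rad u x) * ((∑ i, schoutenFlat u i i x)
    - ∑ i, ∑ j, schoutenFlat u i j x * x i * x j) + (1 + rad u x) ^ 3) * he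

/-! ### Integration by parts and the first variation -/

theorem gdot_contDiff {u v : E4 → ℝ} (hu : ContDiff ℝ ∞ u) (hv : ContDiff ℝ ∞ v) :
    ContDiff ℝ ∞ (gdot u v) :=
  ContDiff.sum fun i _ => (pd_contDiff hu i).mul (pd_contDiff hv i)

theorem lap_contDiff {u : E4 → ℝ} (hu : ContDiff ℝ ∞ u) : ContDiff ℝ ∞ (lap u) :=
  ContDiff.sum fun i _ => pd_contDiff (pd_contDiff hu i) i

theorem coord_contDiff (i : Fin 4) : ContDiff ℝ ∞ (fun x : E4 => x i) := by fun_prop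

theorem rad_contDiff {u : E4 → ℝ} (hu : ContDiff ℝ ∞ u) : ContDiff ℝ ∞ (rad u) :=
  ContDiff.sum fun i _ => (coord_contDiff i).mul (pd_contDiff hu i)

theorem hess_contDiff {u v w : E4 → ℝ} (hu : ContDiff ℝ ∞ u) (hv : ContDiff ℝ ∞ v)
    (hw : ContDiff ℝ ∞ w) : ContDiff ℝ ∞ (hess u v w) :=
  ContDiff.sum fun i _ => ContDiff.sum fun j _ =>
    ((pd_contDiff (pd_contDiff hu j) i).mul (pd_contDiff hv i)).mul (pd_contDiff hw j)

theorem radHess_contDiff {u : E4 → ℝ} (hu : ContDiff ℝ ∞ u) : ContDiff ℝ ∞ (radHess u) :=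
  ContDiff.sum fun i _ => ContDiff.sum fun j _ =>
    ((pd_contDiff (pd_contDiff hu j) i).mul (coord_contDiff i)).mul (coord_contDiff j)

/-- On `S³`, the inner product of the tangential gradients. -/
def tdot (u v : E4 → ℝ) (x : E4) : ℝ := gdot u v x - rad u x * rad v x

theorem tdot_contDiff {u v : E4 → ℝ} (hu : ContDiff ℝ ∞ u) (hv : ContDiff ℝ ∞ v) :
    ContDiff ℝ ∞ (tdot u v) :=
  (gdot_contDiff hu hv).sub ((rad_contDiff hu).mul (rad_contDiff hv))

theorem sum_sq_sphere (ξ : S3) : ∑ i, (ξ : E4) i * (ξ : E4) i = 1 := by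
  rw [← norm_sq_eq_sum]; simp

/-- The divergence theorem on the ball. -/
theorem integral_ball_div {X : Fin 4 → E4 → ℝ} (hX : ∀ i, ContDiff ℝ ∞ (X i)) :
    ∫ x in B4, ∑ i, pd i (X i) x = ∫ ξ : S3, ∑ i, X i ξ * (ξ : E4) i ∂surf := by
  rw [integral_finsetSum _ fun i _ => integrable_ball (pd_contDiff (hX i) i).continuous,
    integral_finsetSum _ fun i _ => integrable_surf
      (f := fun x => X i x * x i) ((hX i).mul (coord_contDiff i)).continuous]
  exact Finset.sum_congr rfl fun i _ => integral_ball_pd (hX i) i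

/-- The divergence theorem on the closed manifold `S³`, for the tangential part of `f ∇g`. The
integrand is the normal component of `Yᵢ = ∑ⱼ ∂ⱼ (f (xᵢ ∂ⱼg - xⱼ ∂ᵢg))`, the divergence of an
antisymmetric tensor; such a field is divergence free on the ball, so its flux vanishes. -/
theorem integral_sphere_tangential {f g : E4 → ℝ} (hf : ContDiff ℝ ∞ f) (hg : ContDiff ℝ ∞ g) :
    ∫ ξ : S3, (tdot f g ξ + f ξ * (lap g ξ - radHess g ξ - 3 * rad g ξ)) ∂surf = 0 := by
  have hf1 := fun i => pd_contDiff hf i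
  have hg1 := fun i => pd_contDiff hg i
  have hg2 := fun i j => pd_contDiff (hg1 j) i
  set W : Fin 4 → Fin 4 → E4 → ℝ := fun i j x => f x * (x i * pd j g x - x j * pd i g x) with hW
  have hWc : ∀ i j, ContDiff ℝ ∞ (W i j) := fun i j =>
    hf.mul (((coord_contDiff i).mul (hg1 j)).sub ((coord_contDiff j).mul (hg1 i)))
  have hWp : ∀ i j x, pd j (W i j) x = pd j f x * (x i * pd j g x - x j * pd i g x)
      + f x * ((if j = i then pd j g x else 0) + x i * pd j (pd j g) x
        - (pd i g x + x j * pd j (pd i g) x)) := by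
    intro i j x
    have d1 := fun i => cd_at (coord_contDiff i) x
    have d2 := fun i => cd_at (hg1 i) x
    simp only [hW]
    rw [pd_mul (cd_at hf x) (((d1 i).fun_mul (d2 j)).fun_sub ((d1 j).fun_mul (d2 i))),
      pd_sub ((d1 i).fun_mul (d2 j)) ((d1 j).fun_mul (d2 i)), pd_mul (d1 i) (d2 j),
      pd_mul (d1 j) (d2 i), pd_coord, pd_coord]
    simp
  set Y : Fin 4 → E4 → ℝ := fun i x => ∑ j, pd j (W i j) x with hY
  have hYc : ∀ i, ContDiff ℝ ∞ (Y i) := fun i =>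
    ContDiff.sum fun j _ => pd_contDiff (hWc i j) j
  have hYp : ∀ i x, pd i (Y i) x = ∑ j, pd i (pd j (W i j)) x := fun i x =>
    pd_sum _ (fun j _ => cd_at (pd_contDiff (hWc i j) j) x) i
  have hanti : ∀ i j x, pd i (pd j (W i j)) x = -pd j (pd i (W j i)) x := by
    intro i j x
    have h1 : W i j = fun y => (-1) * W j i y := by ext y; simp only [hW]; ring
    have h2 : pd j (W i j) = fun y => (-1) * pd j (W j i) y := by
      ext y; conv_lhs => rw [h1]
      exact pd_const_mul _ _
    rw [h2, pd_const_mul, pd_comm (hWc j i)]; ring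
  have hdiv : ∀ x, ∑ i, pd i (Y i) x = 0 := by
    intro x
    simp only [hYp]
    have : ∑ i, ∑ j, pd i (pd j (W i j)) x = -∑ i, ∑ j, pd i (pd j (W i j)) x := by
      conv_lhs => rw [Finset.sum_comm]
      rw [← Finset.sum_neg_distrib]
      refine Finset.sum_congr rfl fun i _ => ?_
      rw [← Finset.sum_neg_distrib]
      exact Finset.sum_congr rfl fun j _ => hanti j i x
    linarith
  have key := integral_ball_div hYc
  simp only [hdiv, integral_zero] at key
  rw [key]
  refine integral_congr_ae (ae_of_all _ fun ξ => ?_)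
  have hn := sum_sq_sphere ξ
  simp only [hY, hWp, tdot, gdot, lap, radHess, rad, Fin.sum_univ_four] at hn ⊢
  simp
  generalize (ξ : E4) = x at *
  linear_combination (-(pd 0 f x * pd 0 g x + pd 1 f x * pd 1 g x + pd 2 f x * pd 2 g x
    + pd 3 f x * pd 3 g x) - f x * (pd 0 (pd 0 g) x + pd 1 (pd 1 g) x + pd 2 (pd 2 g) x
    + pd 3 (pd 3 g) x)) * hn

/-- The trilinear form
`∫ (∇²u(∇v, ∇w) - Δu ⟨∇v, ∇w⟩) + ∮ u_r ⟨∇̄v, ∇̄w⟩`, with `∇̄` the tangential gradient on `S³`. On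
the diagonal it is six times the cubic part of `ℱ₂`. -/
def cubicForm (u v w : E4 → ℝ) : ℝ :=
  (∫ x in B4, (hess u v w x - lap u x * gdot v w x)) + ∫ ξ : S3, rad u ξ * tdot v w ξ ∂surf

theorem sum_schoutenFlat_diag (u : E4 → ℝ) (x : E4) :
    ∑ i, schoutenFlat u i i x = -lap u x - gdot u u x := by
  simp only [schoutenFlat, if_true, Finset.sum_sub_distrib, Finset.sum_add_distrib,
    Finset.sum_neg_distrib, Finset.sum_const, Finset.card_univ, Fintype.card_fin, lap]
  rw [← gdot]
  simp
  ring

theorem sum_schoutenFlat_rad (u : E4 → ℝ) (x : E4) :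
    ∑ i, ∑ j, schoutenFlat u i j x * x i * x j =
      -radHess u x + rad u x ^ 2 - gdot u u x / 2 * ∑ i, x i * x i := by
  simp only [schoutenFlat, radHess, rad, Fin.sum_univ_four]
  simp
  ring

theorem bdryH2Dens_eq (u : E4 → ℝ) (ξ : S3) :
    bdryH2Dens u ξ = (1 + rad u ξ) * (-lap u ξ - gdot u u ξ / 2 + radHess u ξ - rad u ξ ^ 2)
      + (1 + rad u ξ) ^ 3 := by
  rw [bdryH2Dens, sum_schoutenFlat_diag, sum_schoutenFlat_rad, sum_sq_sphere]
  ring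

/-- The vector field whose divergence is `2 σ₂ dvol`:
`Δu ∇u - ∇²u(∇u) + |∇u|² ∇u`. -/
def sigmaField (u : E4 → ℝ) (i : Fin 4) (x : E4) : ℝ :=
  lap u x * pd i u x - (∑ j, pd i (pd j u) x * pd j u x) + gdot u u x * pd i u x

theorem sigmaField_contDiff {u : E4 → ℝ} (hu : ContDiff ℝ ∞ u) (i : Fin 4) :
    ContDiff ℝ ∞ (sigmaField u i) :=
  (((lap_contDiff hu).mul (pd_contDiff hu i)).sub (ContDiff.sum fun j _ =>
    (pd_contDiff (pd_contDiff hu j) i).mul (pd_contDiff hu j))).add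
    ((gdot_contDiff hu hu).mul (pd_contDiff hu i))

theorem pd_gdot {u v : E4 → ℝ} (hu : ContDiff ℝ ∞ u) (hv : ContDiff ℝ ∞ v) (i : Fin 4) (x : E4) :
    pd i (gdot u v) x = ∑ j, (pd i (pd j u) x * pd j v x + pd j u x * pd i (pd j v) x) := by
  have h := pd_sum (x := x) Finset.univ (f := fun j y => pd j u y * pd j v y) (fun j _ =>
    (cd_at (pd_contDiff hu j) x).fun_mul (cd_at (pd_contDiff hv j) x)) i
  refine h.trans (Finset.sum_congr rfl fun j _ => ?_)
  exact pd_mul (cd_at (pd_contDiff hu j) x) (cd_at (pd_contDiff hv j) x) i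

theorem pd_rad {u : E4 → ℝ} (hu : ContDiff ℝ ∞ u) (i : Fin 4) (x : E4) :
    pd i (rad u) x = pd i u x + ∑ j, x j * pd i (pd j u) x := by
  have h := pd_sum (x := x) Finset.univ (f := fun (j : Fin 4) (y : E4) => y j * pd j u y)
    (fun j _ => (cd_at (coord_contDiff j) x).fun_mul (cd_at (pd_contDiff hu j) x)) i
  refine h.trans ?_
  have : ∀ j ∈ Finset.univ, pd i (fun y : E4 => y j * pd j u y) x =
      (if i = j then pd j u x else 0) + x j * pd i (pd j u) x := fun j _ => by
    rw [pd_mul (cd_at (coord_contDiff j) x) (cd_at (pd_contDiff hu j) x), pd_coord]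
    simp
  rw [Finset.sum_congr rfl this]
  simp [Finset.sum_add_distrib]

/-- `2 σ₂ dvol` is a divergence, since the terms with three derivatives cancel. -/
theorem div_sigmaField {u : E4 → ℝ} (hu : ContDiff ℝ ∞ u) (x : E4) :
    ∑ i, pd i (sigmaField u i) x = 2 * sigmaDens u x := by
  have h1 := fun i => pd_contDiff hu i
  have h2 := fun i j => pd_contDiff (h1 j) i
  have c2 : ∀ i j, pd i (pd j u) x = pd j (pd i u) x := fun i j => pd_comm hu i j x
  have c2f : ∀ i j, pd i (pd j u) = pd j (pd i u) := fun i j => funext fun x => pd_comm hu i j x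
  -- the terms with three derivatives cancel
  have c3 : ∀ i j, pd i (pd i (pd j u)) x = pd j (pd i (pd i u)) x := fun i j => by
    rw [c2f i j, pd_comm (h1 i)]
  have hp : ∀ i, pd i (sigmaField u i) x =
      (∑ k, pd i (pd k (pd k u)) x) * pd i u x + lap u x * pd i (pd i u) x
      - (∑ j, (pd j (pd i (pd i u)) x * pd j u x + pd i (pd j u) x * pd i (pd j u) x))
      + ((∑ j, (pd i (pd j u) x * pd j u x + pd j u x * pd i (pd j u) x)) * pd i u x
        + gdot u u x * pd i (pd i u) x) := by
    intro i
    have dl := cd_at (lap_contDiff hu) x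
    have dg := cd_at (gdot_contDiff hu hu) x
    have d1 := fun i => cd_at (h1 i) x
    have d2 := fun i j => cd_at (h2 i j) x
    have ds : DifferentiableAt ℝ (fun y => ∑ j, pd i (pd j u) y * pd j u y) x :=
      DifferentiableAt.fun_sum fun j _ => (d2 i j).fun_mul (d1 j)
    change pd i (fun y => lap u y * pd i u y - (∑ j, pd i (pd j u) y * pd j u y)
      + gdot u u y * pd i u y) x = _
    rw [pd_add ((dl.fun_mul (d1 i)).fun_sub ds) (dg.fun_mul (d1 i)), pd_sub (dl.fun_mul (d1 i)) ds,
      pd_mul dl (d1 i), pd_mul dg (d1 i), pd_gdot hu hu,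
      pd_sum Finset.univ (fun j _ => (d2 i j).fun_mul (d1 j))]
    have e1 : pd i (lap u) x = ∑ k, pd i (pd k (pd k u)) x :=
      pd_sum Finset.univ (fun k _ => d2 k k) i
    rw [e1]
    rw [Finset.sum_congr rfl fun j _ => (pd_mul (d2 i j) (d1 j) i).trans (by rw [c3])]
  simp only [hp, sigmaDens, schoutenFlat, lap, gdot, Fin.sum_univ_four]
  simp
  simp only [c2 1 0, c2 2 0, c2 3 0, c2 2 1, c2 3 1, c2 3 2]
  ring

theorem pd_mul_contDiff {f g : E4 → ℝ} (hf : ContDiff ℝ ∞ f) (hg : ContDiff ℝ ∞ g) (i : Fin 4) :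
    pd i (fun y => f y * g y) = fun x => pd i f x * g x + f x * pd i g x :=
  funext fun x => pd_mul (cd_at hf x) (cd_at hg x) i

theorem tdot_comm (u v : E4 → ℝ) (x : E4) : tdot u v x = tdot v u x := by
  simp only [tdot, gdot, Fin.sum_univ_four]; ring

/-- The pairing of a function `φ` with the curvatures `(σ₂; H₂)` of `e^{2u} dx²`, after integration
by parts: no product of two second derivatives of `u` is left. -/
theorem firstVariation_eq {u φ : E4 → ℝ} (hu : ContDiff ℝ ∞ u) (hφ : ContDiff ℝ ∞ φ) :
    (∫ x in B4, φ x * sigmaDens u x) + ∫ ξ : S3, φ ξ * bdryH2Dens u ξ ∂surf =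
      (∫ ξ : S3, φ ξ ∂surf) + (∫ ξ : S3, tdot u φ ξ ∂surf) + 1 / 2 * cubicForm u u φ
        - 1 / 2 * ∫ x in B4, gdot u u x * gdot u φ x := by
  have hX := sigmaField_contDiff hu
  have hr := rad_contDiff hu
  -- integration by parts in the ball
  have h1 := integral_ball_div (X := fun i x => φ x * sigmaField u i x) fun i => hφ.mul (hX i)
  have h2 : ∀ x, ∑ i, pd i (fun x => φ x * sigmaField u i x) x = 2 * (φ x * sigmaDens u x)
      + (lap u x * gdot u φ x - hess u u φ x + gdot u u x * gdot u φ x) := by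
    intro x
    have : ∀ i, pd i (fun x => φ x * sigmaField u i x) x =
        pd i φ x * sigmaField u i x + φ x * pd i (sigmaField u i) x := fun i =>
      pd_mul (cd_at hφ x) (cd_at (hX i) x) i
    simp only [this, Finset.sum_add_distrib, ← Finset.mul_sum, div_sigmaField hu]
    have : ∑ i, pd i φ x * sigmaField u i x =
        lap u x * gdot u φ x - hess u u φ x + gdot u u x * gdot u φ x := by
      have c2 : ∀ i j, pd i (pd j u) x = pd j (pd i u) x := fun i j => pd_comm hu i j x
      simp only [sigmaField, hess, gdot, Fin.sum_univ_four, c2 1 0, c2 2 0, c2 3 0, c2 2 1, c2 3 1,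
        c2 3 2]
      ring
    rw [this]; ring
  simp only [h2] at h1
  -- the tangential divergence theorem
  have h3 := integral_sphere_tangential hφ hu
  have h4 := integral_sphere_tangential (hφ.mul hr) hu
  have cS : ContDiff ℝ ∞ (sigmaDens u) := by
    have : sigmaDens u = fun x => (1 / 2) * ∑ i, pd i (sigmaField u i) x := by
      ext x; rw [div_sigmaField hu]; ring
    rw [this]
    exact contDiff_const.mul (ContDiff.sum fun i _ => pd_contDiff (hX i) i)
  have cb : ContDiff ℝ ∞ (fun x => φ x * ((1 + rad u x) * (-lap u x - gdot u u x / 2 + radHess u x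
      - rad u x ^ 2) + (1 + rad u x) ^ 3)) := by
    have := lap_contDiff hu; have := gdot_contDiff hu hu; have := radHess_contDiff hu
    fun_prop
  have e1 : ∫ ξ : S3, φ ξ * bdryH2Dens u ξ ∂surf = ∫ ξ : S3, φ ξ * ((1 + rad u ξ) *
      (-lap u ξ - gdot u u ξ / 2 + radHess u ξ - rad u ξ ^ 2) + (1 + rad u ξ) ^ 3) ∂surf := by
    simp only [bdryH2Dens_eq]
  have cT : ContDiff ℝ ∞ (fun x => tdot φ u x + φ x * (lap u x - radHess u x - 3 * rad u x)) := by
    have := lap_contDiff hu; have := tdot_contDiff hφ hu; have := radHess_contDiff hu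
    fun_prop
  have cT2 : ContDiff ℝ ∞ (fun x => tdot (fun x => φ x * rad u x) u x
      + φ x * rad u x * (lap u x - radHess u x - 3 * rad u x)) := by
    have := lap_contDiff hu; have := tdot_contDiff (hφ.mul hr) hu; have := radHess_contDiff hu
    fun_prop
  have cX : ContDiff ℝ ∞ (fun x => ∑ i, φ x * sigmaField u i x * x i) :=
    ContDiff.sum fun i _ => (hφ.mul (hX i)).mul (coord_contDiff i)
  have ct : ContDiff ℝ ∞ (fun x => rad u x * tdot u φ x) := hr.mul (tdot_contDiff hu hφ)
  -- on `S³`, the flux of `φ` times `sigmaField` and the integrands of `h3` and `h4` absorb all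
  -- second derivatives of `u` in `H₂`
  have hpt : ∀ ξ : S3, φ ξ * ((1 + rad u ξ) *
      (-lap u ξ - gdot u u ξ / 2 + radHess u ξ - rad u ξ ^ 2) + (1 + rad u ξ) ^ 3)
      + 1 / 2 * (∑ i, φ ξ * sigmaField u i ξ * (ξ : E4) i)
      + (tdot φ u ξ + φ ξ * (lap u ξ - radHess u ξ - 3 * rad u ξ))
      + 1 / 2 * (tdot (fun x => φ x * rad u x) u ξ
        + φ ξ * rad u ξ * (lap u ξ - radHess u ξ - 3 * rad u ξ)) =
      φ ξ + tdot u φ ξ + 1 / 2 * (rad u ξ * tdot u φ ξ) := by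
    intro ξ
    set x : E4 := (ξ : E4)
    have hn : ∑ i, x i * x i = 1 := sum_sq_sphere ξ
    set m : ℝ := ∑ i, ∑ j, pd i (pd j u) x * pd j u x * x i with hm
    have a1 : ∑ i, φ x * sigmaField u i x * x i =
        φ x * (lap u x * rad u x - m + gdot u u x * rad u x) := by
      simp only [sigmaField, hm, rad, Fin.sum_univ_four]; ring
    have a2 : tdot (fun x => φ x * rad u x) u x = rad u x * tdot φ u x
        + φ x * (gdot u u x + m - (rad u x + radHess u x) * rad u x) := by
      have c2 : ∀ i j, pd i (pd j u) x = pd j (pd i u) x := fun i j => pd_comm hu i j x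
      have b1 : gdot (rad u) u x = gdot u u x + m := by
        simp only [gdot, pd_rad hu, hm, Fin.sum_univ_four, c2 1 0, c2 2 0, c2 3 0, c2 2 1, c2 3 1,
          c2 3 2]
        ring
      have b2 : rad (rad u) x = rad u x + radHess u x := by
        rw [show rad (rad u) x = ∑ i, x i * pd i (rad u) x from rfl]
        simp only [pd_rad hu, radHess]
        rw [rad]
        simp only [Fin.sum_univ_four]; ring
      have b3 : gdot (fun x => φ x * rad u x) u x = rad u x * gdot φ u x
          + φ x * gdot (rad u) u x := by
        simp only [gdot, pd_mul_contDiff hφ hr, Fin.sum_univ_four]; ring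
      have b4 : rad (fun x => φ x * rad u x) x = rad u x * rad φ x + φ x * rad (rad u) x := by
        rw [show rad (fun x => φ x * rad u x) x = ∑ i, x i * pd i (fun x => φ x * rad u x) x
          from rfl, show rad φ x = ∑ i, x i * pd i φ x from rfl,
          show rad (rad u) x = ∑ i, x i * pd i (rad u) x from rfl]
        simp only [pd_mul_contDiff hφ hr, Fin.sum_univ_four]; ring
      simp only [tdot]
      rw [b3, b4, b1, b2]
      ring
    rw [a1, a2, tdot_comm φ u]
    ring
  have hI := integral_congr_ae (μ := surf) (ae_of_all _ hpt)
  have iT := integrable_surf cT.continuous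
  have iT2 := integrable_surf cT2.continuous
  have iX := integrable_surf cX.continuous
  have ib := integrable_surf cb.continuous
  have iφ := integrable_surf hφ.continuous
  have it := integrable_surf (tdot_contDiff hu hφ).continuous
  have irt := integrable_surf ct.continuous
  simp only at hI
  rw [integral_add ((ib.fun_add (iX.const_mul _)).fun_add iT) (iT2.const_mul _),
    integral_add (ib.fun_add (iX.const_mul _)) iT, integral_add ib (iX.const_mul _),
    integral_add (iφ.fun_add it) (irt.const_mul _), integral_add iφ it, integral_const_mul,
    integral_const_mul, integral_const_mul, h3, h4] at hI
  have cl : ContDiff ℝ ∞ (fun x => hess u u φ x - lap u x * gdot u φ x) :=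
    (hess_contDiff hu hu hφ).sub ((lap_contDiff hu).mul (gdot_contDiff hu hφ))
  have cg : ContDiff ℝ ∞ (fun x => gdot u u x * gdot u φ x) :=
    (gdot_contDiff hu hu).mul (gdot_contDiff hu hφ)
  have i1 := integrable_ball (hφ.mul cS).continuous
  have i2 := integrable_ball cl.continuous
  have i3 := integrable_ball cg.continuous
  have h5 : ∫ x in B4, (2 * (φ x * sigmaDens u x)
      + (lap u x * gdot u φ x - hess u u φ x + gdot u u x * gdot u φ x)) =
      2 * (∫ x in B4, φ x * sigmaDens u x) - (∫ x in B4, (hess u u φ x - lap u x * gdot u φ x))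
        + ∫ x in B4, gdot u u x * gdot u φ x := by
    rw [← integral_const_mul, ← integral_sub (i1.const_mul _) i2,
      ← integral_add (integrable_fun_sub (i1.const_mul _) i2) i3]
    congr 1; ext x; ring
  rw [h5] at h1
  rw [e1, cubicForm]
  linarith

/-! ### The energy `ℱ₂` and its second variation -/

theorem pd_smul_fun (s : ℝ) (u : E4 → ℝ) (i : Fin 4) :
    pd i (fun y => s * u y) = fun x => s * pd i u x :=
  funext fun _ => pd_const_mul s i

theorem gdot_const_one (u : E4 → ℝ) (x : E4) : gdot u (fun _ => 1) x = 0 := by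
  simp [gdot, pd_const]

theorem cubicForm_const_one (u v : E4 → ℝ) : cubicForm u v (fun _ => 1) = 0 := by
  have h : ∀ x, hess u v (fun _ => 1) x = 0 := fun x => by simp [hess, pd_const]
  have h2 : ∀ x, rad (fun _ => (1 : ℝ)) x = 0 := fun x => by simp [rad, pd_const]
  simp [cubicForm, tdot, gdot_const_one, h, h2]

/-- The total `(σ₂; H₂)`-curvature is a conformal invariant, equal to its flat value `ω₃`: take
`φ = 1` in `firstVariation_eq`. -/
theorem total_curvature {u : E4 → ℝ} (hu : ContDiff ℝ ∞ u) :
    (∫ x in B4, sigmaDens u x) + ∫ ξ : S3, bdryH2Dens u ξ ∂surf = omega3 := by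
  have h := firstVariation_eq hu (contDiff_const (c := (1 : ℝ)))
  have h2 : ∀ x, rad (fun _ => (1 : ℝ)) x = 0 := fun x => by simp [rad, pd_const]
  simpa [cubicForm_const_one, tdot, gdot_const_one, h2, omega3] using h

/-- `ℱ₂` as a polynomial of degree four in `u`: `firstVariation_eq` for `su` paired with `u`,
integrated over `0 ≤ s ≤ 1`. -/
theorem F2_eq {u : E4 → ℝ} (hu : ContDiff ℝ ∞ u) :
    F2 u = (∫ ξ : S3, u ξ ∂surf) + 1 / 2 * (∫ ξ : S3, tdot u u ξ ∂surf)
      + 1 / 6 * cubicForm u u u - 1 / 8 * ∫ x in B4, gdot u u x ^ 2 := by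
  have hint : ∀ s : ℝ,
      ((∫ x in B4, u x * sigma2 (conf fun y => s * u y) x * volDens (conf fun y => s * u y) x)
      + ∫ ξ : S3, u (ξ : E4) * H2 (conf fun y => s * u y) (ξ : E4)
          * bdryDens (conf fun y => s * u y) (ξ : E4) ∂surf) =
      (∫ ξ : S3, u ξ ∂surf) + s * (∫ ξ : S3, tdot u u ξ ∂surf)
      + s ^ 2 * (1 / 2 * cubicForm u u u) - s ^ 3 * (1 / 2 * ∫ x in B4, gdot u u x ^ 2) := by
    intro s
    have hsu : ContDiff ℝ ∞ (fun y => s * u y) := contDiff_const.mul hu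
    have h := firstVariation_eq hsu hu
    have hn : ∀ ξ : S3, ‖(ξ : E4)‖ = 1 := fun ξ => by simp
    simp only [mul_assoc, sigma2_conf hsu, H2_conf hsu (hn _)]
    rw [h]
    have p := fun i => pd_smul_fun s u i
    have p2 : ∀ i j x, pd i (pd j (fun y => s * u y)) x = s * pd i (pd j u) x := fun i j x => by
      rw [p]; exact pd_const_mul s i
    have e1 : ∀ v x, gdot (fun y => s * u y) v x = s * gdot u v x := fun v x => by
      simp only [gdot, p, Finset.mul_sum, mul_assoc]
    have e1' : ∀ v x, gdot v (fun y => s * u y) x = s * gdot v u x := fun v x => by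
      simp only [gdot, p, Finset.mul_sum]
      exact Finset.sum_congr rfl fun i _ => by ring
    have e2 : ∀ x, rad (fun y => s * u y) x = s * rad u x := fun x => by
      simp only [rad, p, Finset.mul_sum]
      exact Finset.sum_congr rfl fun i _ => by ring
    have e3 : ∀ v x, tdot (fun y => s * u y) v x = s * tdot u v x := fun v x => by
      simp only [tdot, e1, e2]; ring
    have e4 : ∀ x, lap (fun y => s * u y) x = s * lap u x := fun x => by
      simp only [lap, p2, Finset.mul_sum]
    have e5 : ∀ v x, hess (fun y => s * u y) (fun y => s * u y) v x = s ^ 2 * hess u u v x :=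
      fun v x => by
        simp only [hess, p2]
        simp only [p, Finset.mul_sum]
        exact Finset.sum_congr rfl fun i _ => Finset.sum_congr rfl fun j _ => by ring
    have f1 : cubicForm (fun y => s * u y) (fun y => s * u y) u = s ^ 2 * cubicForm u u u := by
      simp only [cubicForm, e1, e2, e3, e4, e5, mul_add, ← integral_const_mul]
      congr 2 <;> ext x <;> ring
    have f2 : ∫ x in B4, gdot (fun y => s * u y) (fun y => s * u y) x
        * gdot (fun y => s * u y) u x = s ^ 3 * ∫ x in B4, gdot u u x ^ 2 := by
      simp only [e1, e1', ← integral_const_mul]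
      congr 1; ext x; ring
    rw [f1, f2]
    simp only [e3, integral_const_mul]
    ring
  rw [F2]
  simp only [hint]
  rw [intervalIntegral.integral_sub (Continuous.intervalIntegrable (by fun_prop) _ _)
      (Continuous.intervalIntegrable (by fun_prop) _ _),
    intervalIntegral.integral_add (Continuous.intervalIntegrable (by fun_prop) _ _)
      (Continuous.intervalIntegrable (by fun_prop) _ _),
    intervalIntegral.integral_add (Continuous.intervalIntegrable (by fun_prop) _ _)
      (Continuous.intervalIntegrable (by fun_prop) _ _)]
  simp only [intervalIntegral.integral_mul_const, integral_id, integral_pow,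
    intervalIntegral.integral_const]
  simp
  ring

theorem pd_add_const (c : ℝ) (u : E4 → ℝ) (i : Fin 4) : pd i (fun y => u y + c) = pd i u := by
  ext x; simp [pd]

/-- Adding a constant changes `ℱ₂` by its multiple of the total curvature `ω₃`. -/
theorem F2_add_const {u : E4 → ℝ} (hu : ContDiff ℝ ∞ u) (c : ℝ) :
    F2 (fun y => u y + c) = F2 u + c * omega3 := by
  rw [F2_eq hu, F2_eq (hu.add contDiff_const)]
  have h1 : ∫ ξ : S3, (u ξ + c) ∂surf = (∫ ξ : S3, u ξ ∂surf) + c * omega3 := by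
    rw [integral_add (integrable_surf hu.continuous) (integrable_const _)]
    simp [omega3, mul_comm]
  simp only [h1, cubicForm, tdot, gdot, rad, hess, lap, pd_add_const]
  ring

/-- The integral over the ball in `cubicForm` is symmetric in its three arguments up to boundary
terms, for which the integral over the sphere compensates. -/
theorem cubicForm_symm {u v : E4 → ℝ} (hu : ContDiff ℝ ∞ u) (hv : ContDiff ℝ ∞ v) :
    cubicForm v u v = cubicForm u v v := by
  have hg := gdot_contDiff hu hv
  have hg' := gdot_contDiff hv hv
  have hZ : ∀ i, ContDiff ℝ ∞ (fun x => gdot v v x * pd i u x - gdot u v x * pd i v x) := fun i =>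
    (hg'.mul (pd_contDiff hu i)).sub (hg.mul (pd_contDiff hv i))
  have h1 := integral_ball_div hZ
  have h2 : ∀ x, ∑ i, pd i (fun x => gdot v v x * pd i u x - gdot u v x * pd i v x) x =
      (hess v u v x - lap v x * gdot u v x) - (hess u v v x - lap u x * gdot v v x) := by
    intro x
    have c2 : ∀ i j, pd i (pd j v) x = pd j (pd i v) x := fun i j => pd_comm hv i j x
    have c2' : ∀ i j, pd i (pd j u) x = pd j (pd i u) x := fun i j => pd_comm hu i j x
    have : ∀ i, pd i (fun x => gdot v v x * pd i u x - gdot u v x * pd i v x) x =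
        (pd i (gdot v v) x * pd i u x + gdot v v x * pd i (pd i u) x)
        - (pd i (gdot u v) x * pd i v x + gdot u v x * pd i (pd i v) x) := fun i => by
      have d1 := cd_at (pd_contDiff hu i) x
      have d2 := cd_at (pd_contDiff hv i) x
      rw [pd_sub ((cd_at hg' x).fun_mul d1) ((cd_at hg x).fun_mul d2), pd_mul (cd_at hg' x) d1,
        pd_mul (cd_at hg x) d2]
    simp only [this, pd_gdot hv hv, pd_gdot hu hv]
    simp only [hess, lap, gdot, Fin.sum_univ_four, c2 1 0, c2 2 0, c2 3 0, c2 2 1, c2 3 1, c2 3 2,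
      c2' 1 0, c2' 2 0, c2' 3 0, c2' 2 1, c2' 3 1, c2' 3 2]
    ring
  simp only [h2] at h1
  have k1 : ContDiff ℝ ∞ fun x => hess v u v x - lap v x * gdot u v x :=
    (hess_contDiff hv hu hv).sub ((lap_contDiff hv).mul hg)
  have k2 : ContDiff ℝ ∞ fun x => hess u v v x - lap u x * gdot v v x :=
    (hess_contDiff hu hv hv).sub ((lap_contDiff hu).mul hg')
  rw [integral_sub (integrable_ball k1.continuous) (integrable_ball k2.continuous)] at h1
  have k3 : ContDiff ℝ ∞ fun x => rad u x * tdot v v x :=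
    (rad_contDiff hu).mul (tdot_contDiff hv hv)
  have k4 : ContDiff ℝ ∞ fun x => rad v x * tdot u v x :=
    (rad_contDiff hv).mul (tdot_contDiff hu hv)
  have h3 : ∫ ξ : S3, ∑ i, (gdot v v (ξ : E4) * pd i u ξ - gdot u v ξ * pd i v ξ) * (ξ : E4) i ∂surf
      = (∫ ξ : S3, rad u ξ * tdot v v ξ ∂surf) - ∫ ξ : S3, rad v ξ * tdot u v ξ ∂surf := by
    rw [← integral_sub (integrable_surf k3.continuous) (integrable_surf k4.continuous)]
    congr 1; ext ξ
    simp only [tdot, rad, Fin.sum_univ_four]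
    ring
  rw [h3] at h1
  rw [cubicForm, cubicForm]
  linarith

/-- The second variation `D_u(v) = ∫ T(∇v, ∇v) + ∮ (1 + u_r) |∇̄v|²` of `ℱ₂`, where
`T = ∇²u - du ⊗ du - (Δu + ½ |du|²) dx²` is the Newton tensor `σ₁ g - P` of `g = e^{2u} dx²`, and
`∇̄` the tangential gradient on `S³`. -/
def secondVariation (u v : E4 → ℝ) : ℝ :=
  (∫ x in B4, (hess u v v x - lap u x * gdot v v x - gdot u v x ^ 2
      - gdot u u x * gdot v v x / 2))
    + ∫ ξ : S3, (1 + rad u ξ) * tdot v v ξ ∂surf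

theorem secondVariation_eq {u v : E4 → ℝ} (hu : ContDiff ℝ ∞ u) (hv : ContDiff ℝ ∞ v) :
    secondVariation u v = cubicForm u v v + (∫ ξ : S3, tdot v v ξ ∂surf)
      - (∫ x in B4, gdot u v x ^ 2) - 1 / 2 * ∫ x in B4, gdot u u x * gdot v v x := by
  have hg := gdot_contDiff hu hv
  have hg' := gdot_contDiff hv hv
  have hg'' := gdot_contDiff hu hu
  have ht := tdot_contDiff hv hv
  have k2 : ContDiff ℝ ∞ fun x => hess u v v x - lap u x * gdot v v x :=
    (hess_contDiff hu hv hv).sub ((lap_contDiff hu).mul hg')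
  have i1 := integrable_ball k2.continuous
  have i2 := integrable_ball (hg.pow 2).continuous
  have i3 := integrable_ball (hg''.mul hg').continuous
  have i4 := integrable_surf ht.continuous
  have i5 := integrable_surf ((rad_contDiff hu).mul ht).continuous
  have e1 : ∫ ξ : S3, (1 + rad u ξ) * tdot v v ξ ∂surf =
      (∫ ξ : S3, tdot v v ξ ∂surf) + ∫ ξ : S3, rad u ξ * tdot v v ξ ∂surf := by
    rw [← integral_add i4 i5]; congr 1; ext ξ; ring
  have e2 : ∫ x in B4, (hess u v v x - lap u x * gdot v v x - gdot u v x ^ 2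
      - gdot u u x * gdot v v x / 2) = (∫ x in B4, (hess u v v x - lap u x * gdot v v x))
      - (∫ x in B4, gdot u v x ^ 2) - 1 / 2 * ∫ x in B4, gdot u u x * gdot v v x := by
    rw [← integral_const_mul, ← integral_sub i1 i2,
      ← integral_sub (integrable_fun_sub i1 i2) (Integrable.const_mul i3 _)]
    congr 1; ext x; ring
  rw [secondVariation, e1, e2, cubicForm]
  ring

/-- The symmetric second difference of `ℱ₂` is its second variation up to `O(t⁴)`. -/
theorem F2_second_difference {u v : E4 → ℝ} (hu : ContDiff ℝ ∞ u) (hv : ContDiff ℝ ∞ v) (t : ℝ) :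
    F2 (fun y => u y + t * v y) + F2 (fun y => u y + (-t) * v y) - 2 * F2 u =
      t ^ 2 * secondVariation u v - t ^ 4 * (1 / 4 * ∫ x in B4, gdot v v x ^ 2) := by
  have hw : ∀ s : ℝ, ContDiff ℝ ∞ (fun y => u y + s * v y) := fun s =>
    hu.add (contDiff_const.mul hv)
  have p : ∀ (s : ℝ) i, pd i (fun y => u y + s * v y) = fun x => pd i u x + s * pd i v x :=
    fun s i => funext fun x => by
      rw [pd_add (cd_at hu x) ((cd_at hv x).const_mul s), pd_const_mul]
  have p2 : ∀ (s : ℝ) i j x, pd i (pd j (fun y => u y + s * v y)) x =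
      pd i (pd j u) x + s * pd i (pd j v) x := fun s i j x => by
    rw [p, pd_add (cd_at (pd_contDiff hu j) x) ((cd_at (pd_contDiff hv j) x).const_mul s),
      pd_const_mul]
  -- `ℱ₂` as one integral over the ball and one over the sphere
  have hF : ∀ w : E4 → ℝ, ContDiff ℝ ∞ w → F2 w =
      (∫ x in B4, (1 / 6 * (hess w w w x - lap w x * gdot w w x) - 1 / 8 * gdot w w x ^ 2))
      + ∫ ξ : S3, (w ξ + 1 / 2 * tdot w w ξ + 1 / 6 * (rad w ξ * tdot w w ξ)) ∂surf := by
    intro w hw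
    have hg := gdot_contDiff hw hw
    have ht := tdot_contDiff hw hw
    have k2 : ContDiff ℝ ∞ fun x => hess w w w x - lap w x * gdot w w x :=
      (hess_contDiff hw hw hw).sub ((lap_contDiff hw).mul hg)
    have i1 := integrable_ball k2.continuous
    have i2 := integrable_ball (hg.pow 2).continuous
    have i3 := integrable_surf hw.continuous
    have i4 := integrable_surf ht.continuous
    have i5 := integrable_surf ((rad_contDiff hw).mul ht).continuous
    rw [F2_eq hw, integral_sub (Integrable.const_mul i1 _) (Integrable.const_mul i2 _),
      integral_add (i3.fun_add (i4.const_mul _)) (i5.const_mul _),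
      integral_add i3 (i4.const_mul _), integral_const_mul, integral_const_mul,
      integral_const_mul, integral_const_mul, cubicForm]
    ring
  have cB : ∀ w : E4 → ℝ, ContDiff ℝ ∞ w → IntegrableOn (fun x =>
      1 / 6 * (hess w w w x - lap w x * gdot w w x) - 1 / 8 * gdot w w x ^ 2) B4 := by
    intro w hw
    have hg := (gdot_contDiff hw hw).continuous
    have hl := (lap_contDiff hw).continuous
    have hh := (hess_contDiff hw hw hw).continuous
    exact integrable_ball (by fun_prop)
  have cS : ∀ w : E4 → ℝ, ContDiff ℝ ∞ w → Integrable (fun ξ : S3 =>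
      w ξ + 1 / 2 * tdot w w ξ + 1 / 6 * (rad w ξ * tdot w w ξ)) surf := by
    intro w hw
    have h1 := hw.continuous
    have h2 := (tdot_contDiff hw hw).continuous
    have h3 := (rad_contDiff hw).continuous
    exact integrable_surf (f := fun x => w x + 1 / 2 * tdot w w x + 1 / 6 * (rad w x * tdot w w x))
      (by fun_prop)
  have hg := gdot_contDiff hu hv
  have hg' := gdot_contDiff hv hv
  have hg'' := gdot_contDiff hu hu
  have ht := tdot_contDiff hv hv
  have k1 : ContDiff ℝ ∞ fun x => hess v u v x - lap v x * gdot u v x :=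
    (hess_contDiff hv hu hv).sub ((lap_contDiff hv).mul hg)
  have k2 : ContDiff ℝ ∞ fun x => hess u v v x - lap u x * gdot v v x :=
    (hess_contDiff hu hv hv).sub ((lap_contDiff hu).mul hg')
  have j1 := integrable_ball k1.continuous
  have j2 := integrable_ball k2.continuous
  have j3 := integrable_ball (hg.pow 2).continuous
  have j4 := integrable_ball (hg''.mul hg').continuous
  have j5 := integrable_ball (hg'.pow 2).continuous
  have j6 := integrable_surf ht.continuous
  have j7 := integrable_surf ((rad_contDiff hu).mul ht).continuous
  have j8 := integrable_surf ((rad_contDiff hv).mul (tdot_contDiff hu hv)).continuous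
  have eB : (∫ x in B4, (1 / 6 * (hess (fun y => u y + t * v y) (fun y => u y + t * v y)
        (fun y => u y + t * v y) x - lap (fun y => u y + t * v y) x
        * gdot (fun y => u y + t * v y) (fun y => u y + t * v y) x)
        - 1 / 8 * gdot (fun y => u y + t * v y) (fun y => u y + t * v y) x ^ 2))
      + (∫ x in B4, (1 / 6 * (hess (fun y => u y + (-t) * v y) (fun y => u y + (-t) * v y)
        (fun y => u y + (-t) * v y) x - lap (fun y => u y + (-t) * v y) x
        * gdot (fun y => u y + (-t) * v y) (fun y => u y + (-t) * v y) x)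
        - 1 / 8 * gdot (fun y => u y + (-t) * v y) (fun y => u y + (-t) * v y) x ^ 2))
      - 2 * (∫ x in B4, (1 / 6 * (hess u u u x - lap u x * gdot u u x) - 1 / 8 * gdot u u x ^ 2)) =
      t ^ 2 / 3 * (∫ x in B4, (hess u v v x - lap u x * gdot v v x))
      + 2 * t ^ 2 / 3 * (∫ x in B4, (hess v u v x - lap v x * gdot u v x))
      - t ^ 2 * (∫ x in B4, gdot u v x ^ 2) - t ^ 2 / 2 * (∫ x in B4, gdot u u x * gdot v v x)
      - t ^ 4 / 4 * (∫ x in B4, gdot v v x ^ 2) := by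
    simp only [← integral_const_mul]
    rw [← integral_add (cB _ (hw t)) (cB _ (hw (-t))),
      ← integral_sub (Integrable.fun_add (cB _ (hw t)) (cB _ (hw (-t))))
        (Integrable.const_mul (cB _ hu) _),
      ← integral_add (Integrable.const_mul j2 _) (Integrable.const_mul j1 _),
      ← integral_sub (Integrable.fun_add (Integrable.const_mul j2 _) (Integrable.const_mul j1 _))
        (Integrable.const_mul j3 _),
      ← integral_sub (integrable_fun_sub (Integrable.fun_add (Integrable.const_mul j2 _)
        (Integrable.const_mul j1 _)) (Integrable.const_mul j3 _)) (Integrable.const_mul j4 _),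
      ← integral_sub (integrable_fun_sub (integrable_fun_sub (Integrable.fun_add
        (Integrable.const_mul j2 _) (Integrable.const_mul j1 _)) (Integrable.const_mul j3 _))
        (Integrable.const_mul j4 _)) (Integrable.const_mul j5 _)]
    congr 1; ext x
    have c2 : ∀ i j, pd i (pd j v) x = pd j (pd i v) x := fun i j => pd_comm hv i j x
    simp only [hess, lap, gdot, p2]
    simp only [p, Fin.sum_univ_four, c2 1 0, c2 2 0, c2 3 0, c2 2 1, c2 3 1, c2 3 2]
    ring
  have eS : (∫ ξ : S3, ((fun y => u y + t * v y) ξ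
        + 1 / 2 * tdot (fun y => u y + t * v y) (fun y => u y + t * v y) ξ
        + 1 / 6 * (rad (fun y => u y + t * v y) ξ
          * tdot (fun y => u y + t * v y) (fun y => u y + t * v y) ξ)) ∂surf)
      + (∫ ξ : S3, ((fun y => u y + (-t) * v y) ξ
        + 1 / 2 * tdot (fun y => u y + (-t) * v y) (fun y => u y + (-t) * v y) ξ
        + 1 / 6 * (rad (fun y => u y + (-t) * v y) ξ
          * tdot (fun y => u y + (-t) * v y) (fun y => u y + (-t) * v y) ξ)) ∂surf)
      - 2 * (∫ ξ : S3, (u ξ + 1 / 2 * tdot u u ξ + 1 / 6 * (rad u ξ * tdot u u ξ)) ∂surf) =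
      t ^ 2 * (∫ ξ : S3, tdot v v ξ ∂surf)
      + t ^ 2 / 3 * (∫ ξ : S3, rad u ξ * tdot v v ξ ∂surf)
      + 2 * t ^ 2 / 3 * (∫ ξ : S3, rad v ξ * tdot u v ξ ∂surf) := by
    simp only [← integral_const_mul]
    rw [← integral_add (cS _ (hw t)) (cS _ (hw (-t))),
      ← integral_sub ((cS _ (hw t)).fun_add (cS _ (hw (-t)))) ((cS _ hu).const_mul _),
      ← integral_add (j6.const_mul _) (j7.const_mul _),
      ← integral_add ((j6.const_mul _).fun_add (j7.const_mul _)) (j8.const_mul _)]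
    congr 1; ext ξ
    simp only [tdot, rad, gdot, p]
    simp only [Fin.sum_univ_four]
    ring
  rw [hF _ (hw t), hF _ (hw (-t)), hF _ hu, secondVariation_eq hu hv]
  have hs := cubicForm_symm hu hv
  rw [cubicForm, cubicForm] at hs
  rw [cubicForm]
  simp only at eS ⊢
  linear_combination eB + eS + 2 * t ^ 2 / 3 * hs

/-! ### The second variation inequality at a minimizer -/

theorem contDiff_integral_exp {p v : E4 → ℝ} (hp : Continuous p) (hv : Continuous v) :
    ContDiff ℝ ∞ fun t : ℝ => ∫ ξ : S3, p ξ * Real.exp (t * v ξ) ∂surf := by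
  have hder : ∀ (p : E4 → ℝ), Continuous p → ∀ t : ℝ,
      HasDerivAt (fun t : ℝ => ∫ ξ : S3, p ξ * Real.exp (t * v ξ) ∂surf)
        (∫ ξ : S3, (p ξ * v ξ) * Real.exp (t * v ξ) ∂surf) t := by
    intro p hp t
    refine hasDerivAt_integral_sphere (F := fun t ξ => p ξ * Real.exp (t * v ξ))
      (F' := fun t ξ => (p ξ * v ξ) * Real.exp (t * v ξ)) (fun r => by fun_prop) (fun r ξ => ?_)
      (by fun_prop) t
    have h1 : HasDerivAt (fun r => r * v ξ) (v ξ) r := by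
      simpa using (hasDerivAt_id r).mul_const (v ξ)
    have h2 := (h1.exp.const_mul (p ξ))
    rwa [show p ξ * (Real.exp (r * v ξ) * v ξ) = p ξ * v ξ * Real.exp (r * v ξ) by ring] at h2
  rw [contDiff_infty]
  intro n
  induction n generalizing p with
  | zero =>
    rw [Nat.cast_zero, contDiff_zero]
    exact continuous_iff_continuousAt.2 fun t => (hder p hp t).continuousAt
  | succ n ih =>
    rw [show ((n + 1 : ℕ) : WithTop ℕ∞) = (n : WithTop ℕ∞) + 1 by norm_cast,
      contDiff_succ_iff_deriv]
    refine ⟨fun t => (hder p hp t).differentiableAt, by simp, ?_⟩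
    rw [show deriv (fun t : ℝ => ∫ ξ : S3, p ξ * Real.exp (t * v ξ) ∂surf) =
      fun t : ℝ => ∫ ξ : S3, (p ξ * v ξ) * Real.exp (t * v ξ) ∂surf from
        funext fun t => (hder p hp t).deriv]
    exact ih (hp.mul hv)

theorem bdryVol_conf (u : E4 → ℝ) :
    bdryVol (conf u) = ∫ ξ : S3, Real.exp (3 * u ξ) ∂surf := by
  rw [bdryVol]
  congr 1; ext ξ
  exact bdryDens_conf u (by simp)

theorem sphere_integral_exp_pos {u : E4 → ℝ} (hu : Continuous u) :
    0 < ∫ ξ : S3, Real.exp (u ξ) ∂surf := by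
  have : NeZero surf := ⟨by unfold surf; exact Measure.toSphere_ne_zero _⟩
  exact integral_exp_pos (f := fun ξ : S3 => u ξ)
    (integrable_surf (f := fun x => Real.exp (u x)) (by fun_prop))

/-- Minimality of `𝒢₂` at `u` to second order along the lines `u + t v`. -/
def IsAffineMin (u : E4 → ℝ) : Prop :=
  ∀ v : E4 → ℝ, ContDiff ℝ ∞ v → ∀ ε > 0, ∀ᶠ t in 𝓝 (0 : ℝ),
    G2 u - ε * t ^ 2 ≤ G2 fun y => u y + t * v y

theorem affine_contDiff {u v : E4 → ℝ} (hu : ContDiff ℝ ∞ u) (hv : ContDiff ℝ ∞ v) :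
    ContDiff ℝ ∞ fun p : ℝ × E4 => u p.2 + p.1 * v p.2 :=
  (hu.comp contDiff_snd).add (contDiff_fst.mul (hv.comp contDiff_snd))

theorem isAffineMin_of_G2 {u : E4 → ℝ} (h : IsLocalMinToSecondOrderOn G2 smoothFns u) :
    IsAffineMin u := by
  obtain ⟨hu, hmin⟩ := h
  have hu : ContDiff ℝ ∞ u := hu
  intro v hv
  exact hmin (fun t y => u y + t * v y) (affine_contDiff hu hv)
    (fun t => hu.add (contDiff_const.mul hv)) (by ext; simp)

/-- The curve `u + t v - c(t)`, with the constants `c(t)` that restore the volume, lies in `𝒱`, and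
`ℱ₂` along it is `𝒢₂` along the line `u + t v`. -/
theorem isAffineMin_of_F2 {u : E4 → ℝ} (h : IsLocalMinToSecondOrderOn F2 volV u) :
    IsAffineMin u := by
  obtain ⟨⟨hu, hV⟩, hmin⟩ := h
  rw [bdryVol_conf] at hV
  intro v hv
  have hω := omega3_pos
  have hw : ∀ t : ℝ, ContDiff ℝ ∞ (fun y => u y + t * v y) := fun t =>
    hu.add (contDiff_const.mul hv)
  set a : ℝ → ℝ := fun t => ∫ ξ : S3, Real.exp (3 * (u ξ + t * v ξ)) ∂surf with ha
  have hapos : ∀ t, 0 < a t := fun t =>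
    sphere_integral_exp_pos (u := fun x => 3 * (u x + t * v x))
      (by have := (hw t).continuous; fun_prop)
  have hac : ContDiff ℝ ∞ a := by
    have := contDiff_integral_exp (p := fun x => Real.exp (3 * u x)) (v := fun x => 3 * v x)
      (by have := hu.continuous; fun_prop) (by have := hv.continuous; fun_prop)
    have e : a = fun t => ∫ ξ : S3, Real.exp (3 * u ξ) * Real.exp (t * (3 * v ξ)) ∂surf := by
      ext t; simp only [ha, ← Real.exp_add]; congr 1; ext ξ; ring_nf
    rw [e]; exact this
  set c : ℝ → ℝ := fun t => 1 / 3 * Real.log (a t / omega3) with hc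
  have hcc : ContDiff ℝ ∞ c := contDiff_const.mul
    ((hac.div_const _).log fun t => (div_pos (hapos t) hω).ne')
  have hexp : ∀ t, Real.exp (3 * -c t) = omega3 / a t := fun t => by
    rw [hc, show 3 * -(1 / 3 * Real.log (a t / omega3)) = -Real.log (a t / omega3) by ring,
      Real.exp_neg, Real.exp_log (div_pos (hapos t) hω), inv_div]
  have hG0 : G2 u = F2 u := by
    rw [G2, hV, div_self hω.ne']; simp
  have hmin' := hmin (fun t y => u y + t * v y + -c t)
    ((affine_contDiff hu hv).add (hcc.comp contDiff_fst).neg)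
    (fun t => ⟨(hw t).add contDiff_const, by
      rw [bdryVol_conf]
      simp only [mul_add, Real.exp_add, hexp, integral_mul_const]
      have : a t = ∫ ξ : S3, Real.exp (3 * u ξ) * Real.exp (3 * (t * v ξ)) ∂surf := by
        simp only [ha, mul_add, Real.exp_add]
      rw [← this]
      field_simp [(hapos t).ne']⟩)
    (by
      have h0 : c 0 = 0 := by
        simp [hc, ha, hV, hω.ne']
      ext y; simp [h0])
  intro ε hε
  filter_upwards [hmin' ε hε] with t ht
  rw [F2_add_const (hw t)] at ht
  rw [hG0, G2]
  have : c t * omega3 = omega3 / 3 * Real.log (a t / omega3) := by rw [hc]; ring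
  linarith

theorem exp_ge_cubic (s : ℝ) : 1 + s + s ^ 2 / 2 + s ^ 3 / 6 ≤ Real.exp s := by
  set h : ℝ → ℝ := fun s => Real.exp (-s) * (1 + s + s ^ 2 / 2 + s ^ 3 / 6) with hh
  have hd : ∀ s, HasDerivAt h (-(Real.exp (-s) * s ^ 3 / 6)) s := fun s => by
    have h1 : HasDerivAt (fun s : ℝ => Real.exp (-s)) (-Real.exp (-s)) s := by
      simpa using (hasDerivAt_neg s).exp
    have h2 : HasDerivAt (fun s : ℝ => 1 + s + s ^ 2 / 2 + s ^ 3 / 6)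
        (1 + s + s ^ 2 / 2) s := by
      have := (((hasDerivAt_id s).const_add 1).add ((hasDerivAt_pow 2 s).div_const 2)).add
        ((hasDerivAt_pow 3 s).div_const 6)
      refine this.congr_deriv ?_
      simp; ring
    refine (h1.mul h2).congr_deriv ?_
    ring
  have hcont : Continuous h := continuous_iff_continuousAt.2 fun s => (hd s).continuousAt
  have key : h s ≤ 1 := by
    have h0 : h 0 = 1 := by simp [hh]
    rw [← h0]
    rcases le_total s 0 with hs | hs
    · refine monotoneOn_of_deriv_nonneg (convex_Iic (0 : ℝ)) hcont.continuousOn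
        (fun x _ => (hd x).differentiableAt.differentiableWithinAt) (fun x hx => ?_) hs
        (mem_Iic.2 le_rfl) hs
      rw [interior_Iic] at hx
      rw [(hd x).deriv]
      have : x ^ 3 ≤ 0 := by
        have : x < 0 := hx
        nlinarith [mul_nonneg (sq_nonneg x) (neg_nonneg.2 this.le)]
      nlinarith [Real.exp_pos (-x)]
    · refine antitoneOn_of_deriv_nonpos (convex_Ici (0 : ℝ)) hcont.continuousOn
        (fun x _ => (hd x).differentiableAt.differentiableWithinAt) (fun x hx => ?_)
        (mem_Ici.2 le_rfl) hs hs
      rw [interior_Ici] at hx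
      rw [(hd x).deriv]
      have : 0 < x := hx
      have : 0 ≤ Real.exp (-x) * x ^ 3 / 6 := by positivity
      linarith
  have h3 := mul_le_mul_of_nonneg_left key (Real.exp_pos s).le
  simp only [hh, ← mul_assoc, ← Real.exp_add] at h3
  simpa using h3

theorem log_one_add_ge {y : ℝ} (hy : -(1 / 2) ≤ y) : y - 2 * y ^ 2 ≤ Real.log (1 + y) := by
  have h1 : 0 < 1 + y := by linarith
  have h2 := Real.one_sub_inv_le_log_of_pos h1
  refine le_trans ?_ h2
  have : 1 - (1 + y)⁻¹ = y / (1 + y) := by field_simp; ring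
  rw [this, le_div_iff₀ h1]
  nlinarith [mul_nonneg (sq_nonneg y) (by linarith : 0 ≤ 1 + 2 * y)]

/-- The second variation inequality of `𝒢₂` at `u`, in a direction `v` that is balanced for the
measure `e^{3u} dσ`. No derivative of `log ∮ e^{3(u + tv)}` is taken: the elementary lower bounds
`exp_ge_cubic` and `log_one_add_ge` control its second difference to order `t²`. -/
theorem secondVariation_ge {u v : E4 → ℝ} (hu : ContDiff ℝ ∞ u) (hv : ContDiff ℝ ∞ v)
    (hmin : IsAffineMin u) (hbal : ∫ ξ : S3, v ξ * Real.exp (3 * u ξ) ∂surf = 0) :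
    3 * omega3 / (∫ ξ : S3, Real.exp (3 * u ξ) ∂surf) *
      (∫ ξ : S3, v ξ ^ 2 * Real.exp (3 * u ξ) ∂surf) ≤ secondVariation u v := by
  have huc := hu.continuous
  have hvc := hv.continuous
  have hω := omega3_pos
  set M := ∫ ξ : S3, Real.exp (3 * u ξ) ∂surf with hM
  set m2 := ∫ ξ : S3, v ξ ^ 2 * Real.exp (3 * u ξ) ∂surf with hm2
  set m3 := ∫ ξ : S3, v ξ ^ 3 * Real.exp (3 * u ξ) ∂surf with hm3
  have hMpos : 0 < M := sphere_integral_exp_pos (u := fun x => 3 * u x) (by fun_prop)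
  set a : ℝ → ℝ := fun t => ∫ ξ : S3, Real.exp (3 * (u ξ + t * v ξ)) ∂surf with ha
  have hapos : ∀ t, 0 < a t := fun t =>
    sphere_integral_exp_pos (u := fun x => 3 * (u x + t * v x)) (by fun_prop)
  set z : ℝ → ℝ := fun t => 9 / 2 * (m2 + t * m3) / M with hz
  have hzc : Continuous z := by fun_prop
  -- the cubic lower bound for `exp`, integrated; the linear term vanishes by balancing
  have haz : ∀ t, M * (1 + t ^ 2 * z t) ≤ a t := by
    intro t
    have i0 := integrable_surf (f := fun x => Real.exp (3 * u x)) (by fun_prop)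
    have i1 := integrable_surf (f := fun x => v x * Real.exp (3 * u x)) (by fun_prop)
    have i2 := integrable_surf (f := fun x => v x ^ 2 * Real.exp (3 * u x)) (by fun_prop)
    have i3 := integrable_surf (f := fun x => v x ^ 3 * Real.exp (3 * u x)) (by fun_prop)
    have i4 := integrable_surf (f := fun x => Real.exp (3 * (u x + t * v x))) (by fun_prop)
    have e1 : M * (1 + t ^ 2 * z t) = ∫ ξ : S3, (Real.exp (3 * u ξ)
        + 3 * t * (v ξ * Real.exp (3 * u ξ)) + 9 / 2 * t ^ 2 * (v ξ ^ 2 * Real.exp (3 * u ξ))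
        + 9 / 2 * t ^ 3 * (v ξ ^ 3 * Real.exp (3 * u ξ))) ∂surf := by
      rw [integral_add ((i0.fun_add (i1.const_mul _)).fun_add (i2.const_mul _)) (i3.const_mul _),
        integral_add (i0.fun_add (i1.const_mul _)) (i2.const_mul _),
        integral_add i0 (i1.const_mul _), integral_const_mul, integral_const_mul,
        integral_const_mul, hbal, ← hM, ← hm2, ← hm3, hz]
      field_simp
      ring
    rw [e1]
    refine integral_mono (((i0.fun_add (i1.const_mul _)).fun_add (i2.const_mul _)).fun_add
      (i3.const_mul _)) i4 fun ξ => ?_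
    have h1 := mul_le_mul_of_nonneg_left (exp_ge_cubic (3 * (t * v ξ)))
      (Real.exp_pos (3 * u ξ)).le
    simp only [mul_add (3 : ℝ), Real.exp_add]
    refine le_trans (le_of_eq ?_) h1
    ring
  set K := 1 / 4 * ∫ x in B4, gdot v v x ^ 2 with hK
  -- `t² g(t)` bounds the second difference of `𝒢₂` from above
  set g : ℝ → ℝ := fun t => secondVariation u v - t ^ 2 * K
    - omega3 / 3 * (z t + z (-t) - 2 * t ^ 2 * (z t ^ 2 + z (-t) ^ 2)) with hg
  have hgc : Continuous g := by fun_prop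
  have hg0 : g 0 = secondVariation u v - 3 * omega3 / M * m2 := by
    simp only [hg, hz]; ring
  have hlog : ∀ t, -(1 / 2) ≤ t ^ 2 * z t →
      t ^ 2 * z t - 2 * (t ^ 2 * z t) ^ 2 ≤ Real.log (a t / omega3) - Real.log (M / omega3) := by
    intro t ht
    refine (log_one_add_ge ht).trans ?_
    rw [Real.log_div (hapos t).ne' hω.ne', Real.log_div hMpos.ne' hω.ne']
    have h1 : 0 < 1 + t ^ 2 * z t := by linarith
    have h2 := Real.log_le_log (mul_pos hMpos h1) (haz t)
    rw [Real.log_mul hMpos.ne' h1.ne'] at h2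
    linarith
  have hsmall : ∀ᶠ t in 𝓝 (0 : ℝ), -(1 / 2) ≤ t ^ 2 * z t := by
    have hc : Continuous fun t => t ^ 2 * z t := by fun_prop
    have h0 : -(1 / 2) < (0 : ℝ) ^ 2 * z 0 := by norm_num
    exact (hc.continuousAt.eventually (lt_mem_nhds h0)).mono fun t ht => le_of_lt ht
  have hneg : Tendsto (fun t : ℝ => -t) (𝓝 0) (𝓝 0) := by
    simpa using (continuous_neg (G := ℝ)).tendsto 0
  have main : ∀ ε > 0, -2 * ε ≤ g 0 := by
    intro ε hε
    have hev : ∀ᶠ t in 𝓝[≠] (0 : ℝ), -2 * ε ≤ g t := by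
      have h1 := hmin v hv ε hε
      have h2 := hneg.eventually h1
      have h3 := hneg.eventually hsmall
      filter_upwards [mem_nhdsWithin_of_mem_nhds h1, mem_nhdsWithin_of_mem_nhds h2,
        mem_nhdsWithin_of_mem_nhds h3, mem_nhdsWithin_of_mem_nhds hsmall, self_mem_nhdsWithin]
        with t k1 k2 k3 k4 k5
      have l1 := hlog t k4
      have l2 := hlog (-t) k3
      have hF := F2_second_difference hu hv t
      have b1 : G2 (fun y => u y + t * v y) = F2 (fun y => u y + t * v y)
        - omega3 / 3 * Real.log (a t / omega3) := rfl
      have b2 : G2 (fun y => u y + -t * v y) = F2 (fun y => u y + -t * v y)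
        - omega3 / 3 * Real.log (a (-t) / omega3) := rfl
      have b3 : G2 u = F2 u - omega3 / 3 * Real.log (M / omega3) := rfl
      simp only [b1, b2, b3] at k1 k2
      have l3 := mul_le_mul_of_nonneg_left (add_le_add l1 l2) (by positivity : 0 ≤ omega3 / 3)
      have ht2 : 0 < t ^ 2 := by have : t ≠ 0 := k5; positivity
      have : t ^ 2 * (-2 * ε) ≤ t ^ 2 * g t := by
        simp only [hg]
        simp only [neg_sq] at l3 k2
        linear_combination k1 + k2 + l3 + hF
      exact le_of_mul_le_mul_left this ht2
    exact ge_of_tendsto ((hgc.tendsto 0).mono_left nhdsWithin_le_nhds) hev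
  have : 0 ≤ g 0 := by
    refine le_of_forall_pos_le_add fun ε hε => ?_
    have := main (ε / 2) (by positivity)
    linarith
  rw [hg0] at this
  linarith

/-! ### Möbius translations of the ball -/

/-- The denominator `1 - 2⟨a, x⟩ + |a|²|x|²` of the Möbius translation; on `S³` it is `|x - a|²`. -/
def mobDen (a x : E4) : ℝ := 1 - 2 * inner ℝ a x + ‖a‖ ^ 2 * ‖x‖ ^ 2

/-- The Möbius translation of the ball carrying `a` to `0`,
`x ↦ (1 - |a|²) (x - |x|² a) / (1 - 2⟨a, x⟩ + |a|²|x|²) - a`. -/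
def mob (a x : E4) : E4 := ((1 - ‖a‖ ^ 2) / mobDen a x) • (x - ‖x‖ ^ 2 • a) - a

/-- The logarithm of the conformal factor `(1 - |a|²) / mobDen a` of the Möbius translation. -/
def mobLog (a x : E4) : ℝ := Real.log (1 - ‖a‖ ^ 2) - Real.log (mobDen a x)

theorem mobDen_pos {a x : E4} (h : ‖a‖ * ‖x‖ < 1) : 0 < mobDen a x := by
  have h1 := real_inner_le_norm a x
  have : 0 < (1 - ‖a‖ * ‖x‖) ^ 2 := by have : 0 < 1 - ‖a‖ * ‖x‖ := by linarith
                                       positivity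
  rw [mobDen]; nlinarith

theorem mobDen_pos_of_mem {a x : E4} (ha : ‖a‖ < 1) (hx : x ∈ B4) : 0 < mobDen a x := by
  have hx : ‖x‖ ≤ 1 := by simpa using hx
  exact mobDen_pos (by nlinarith [norm_nonneg a, norm_nonneg x])

theorem one_sub_sq_pos {a : E4} (ha : ‖a‖ < 1) : 0 < 1 - ‖a‖ ^ 2 := by
  nlinarith [norm_nonneg a]

theorem mobDen_contDiff (a : E4) : ContDiff ℝ ∞ (mobDen a) := by
  have h : ContDiff ℝ ∞ fun x : E4 => ‖x‖ ^ 2 := contDiff_norm_sq ℝ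
  have h2 : ContDiff ℝ ∞ fun x : E4 => inner ℝ a x := contDiff_const.inner ℝ contDiff_id
  unfold mobDen
  fun_prop

theorem mob_contDiffAt {a x : E4} (h : mobDen a x ≠ 0) : ContDiffAt ℝ ∞ (mob a) x := by
  have h1 : ContDiff ℝ ∞ fun x : E4 => x - ‖x‖ ^ 2 • a :=
    contDiff_id.sub ((contDiff_norm_sq ℝ).smul contDiff_const)
  exact (((contDiffAt_const).div (mobDen_contDiff a).contDiffAt h).smul h1.contDiffAt).sub
    contDiffAt_const

theorem mobLog_contDiffAt {a x : E4} (h : mobDen a x ≠ 0) : ContDiffAt ℝ ∞ (mobLog a) x :=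
  contDiffAt_const.sub ((mobDen_contDiff a).contDiffAt.log h)

theorem exp_mobLog {a x : E4} (ha : ‖a‖ < 1) (h : 0 < mobDen a x) :
    Real.exp (mobLog a x) = (1 - ‖a‖ ^ 2) / mobDen a x := by
  rw [mobLog, Real.exp_sub, Real.exp_log (one_sub_sq_pos ha), Real.exp_log h]

theorem inner_mob {a x : E4} : inner ℝ a (mob a x) =
    (1 - ‖a‖ ^ 2) / mobDen a x * (inner ℝ a x - ‖x‖ ^ 2 * ‖a‖ ^ 2) - ‖a‖ ^ 2 := by
  simp only [mob, inner_sub_right, inner_smul_right, real_inner_self_eq_norm_sq]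

theorem norm_mob_sq {a x : E4} (h : mobDen a x ≠ 0) :
    ‖mob a x‖ ^ 2 = 1 - (1 - ‖a‖ ^ 2) / mobDen a x * (1 - ‖x‖ ^ 2) := by
  rw [← real_inner_self_eq_norm_sq (mob a x)]
  simp only [mob, inner_sub_left, inner_sub_right, real_inner_smul_left, inner_smul_right,
    real_inner_self_eq_norm_sq, real_inner_comm a x]
  have h' := h
  rw [mobDen] at h'
  rw [mobDen]
  field_simp
  ring

theorem mobDen_neg_mob {a x : E4} (h : mobDen a x ≠ 0) :
    mobDen (-a) (mob a x) = (1 - ‖a‖ ^ 2) ^ 2 / mobDen a x := by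
  rw [mobDen, inner_neg_left, norm_neg, norm_mob_sq h, inner_mob]
  field_simp
  rw [mobDen]
  ring

theorem mob_neg_mob {a x : E4} (ha : ‖a‖ < 1) (h : mobDen a x ≠ 0) : mob (-a) (mob a x) = x := by
  have hα := (one_sub_sq_pos ha).ne'
  conv_lhs => rw [mob]
  rw [mobDen_neg_mob h, norm_neg, norm_mob_sq h]
  have e1 : mob a x - (1 - (1 - ‖a‖ ^ 2) / mobDen a x * (1 - ‖x‖ ^ 2)) • -a =
      ((1 - ‖a‖ ^ 2) / mobDen a x) • (x - a) := by
    rw [mob]; module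
  rw [e1, smul_smul]
  have e2 : (1 - ‖a‖ ^ 2) / ((1 - ‖a‖ ^ 2) ^ 2 / mobDen a x) *
      ((1 - ‖a‖ ^ 2) / mobDen a x) = 1 := by
    field_simp
  rw [e2]; simp

theorem hasFDerivAt_mobDen (a x : E4) :
    HasFDerivAt (mobDen a) ((-2 : ℝ) • innerSL ℝ a + (2 * ‖a‖ ^ 2) • innerSL ℝ x) x := by
  have h1 : HasFDerivAt (fun x : E4 => ‖x‖ ^ 2) (2 • innerSL ℝ x) x :=
    (hasStrictFDerivAt_norm_sq x).hasFDerivAt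
  have h2 : HasFDerivAt (fun x : E4 => inner ℝ a x) (innerSL ℝ a) x := (innerSL ℝ a).hasFDerivAt
  have h3 := ((h2.const_mul 2).const_sub 1).add (h1.const_mul (‖a‖ ^ 2))
  refine h3.congr_fderiv ?_
  ext v; simp; ring

theorem fderiv_mob {a x : E4} (h : mobDen a x ≠ 0) (v : E4) :
    fderiv ℝ (mob a) x v = ((1 - ‖a‖ ^ 2) / mobDen a x) • (v - (2 * inner ℝ x v) • a)
      - ((1 - ‖a‖ ^ 2) / mobDen a x ^ 2 * (-2 * inner ℝ a v + 2 * ‖a‖ ^ 2 * inner ℝ x v)) •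
        (x - ‖x‖ ^ 2 • a) := by
  have h1 : HasFDerivAt (fun x : E4 => ‖x‖ ^ 2) (2 • innerSL ℝ x) x :=
    (hasStrictFDerivAt_norm_sq x).hasFDerivAt
  have h2 := (hasFDerivAt_id x).sub (h1.smul_const a)
  have h3 : HasFDerivAt (fun x => (1 - ‖a‖ ^ 2) / mobDen a x) _ x :=
    ((hasDerivAt_inv h).const_mul (1 - ‖a‖ ^ 2)).comp_hasFDerivAt x (hasFDerivAt_mobDen a x)
  have h4 : HasFDerivAt (mob a) _ x := (h3.smul h2).sub_const a
  rw [h4.fderiv]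
  simp
  module

/-- The Möbius translation is conformal with factor `(1 - |a|²) / mobDen a`. -/
theorem inner_fderiv_mob {a x : E4} (h : mobDen a x ≠ 0) (v w : E4) :
    inner ℝ (fderiv ℝ (mob a) x v) (fderiv ℝ (mob a) x w) =
      ((1 - ‖a‖ ^ 2) / mobDen a x) ^ 2 * inner ℝ v w := by
  rw [fderiv_mob h, fderiv_mob h]
  simp only [inner_sub_left, inner_sub_right, real_inner_smul_left, inner_smul_right,
    real_inner_self_eq_norm_sq]
  rw [real_inner_comm a x, real_inner_comm x v, real_inner_comm a v]
  have hs : inner ℝ a x = (1 + ‖a‖ ^ 2 * ‖x‖ ^ 2 - mobDen a x) / 2 := by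
    rw [mobDen]; ring
  rw [hs]
  generalize mobDen a x = q at *
  field_simp
  ring

theorem mob_mapsTo {a : E4} (ha : ‖a‖ < 1) : MapsTo (mob a) B4 B4 := by
  intro x hx
  have h := mobDen_pos_of_mem ha hx
  have hx : ‖x‖ ≤ 1 := by simpa using hx
  have h1 := norm_mob_sq h.ne'
  have h2 : 0 ≤ (1 - ‖a‖ ^ 2) / mobDen a x * (1 - ‖x‖ ^ 2) :=
    mul_nonneg (div_nonneg (one_sub_sq_pos ha).le h.le) (by nlinarith [norm_nonneg x])
  have : ‖mob a x‖ ≤ 1 := by nlinarith [norm_nonneg (mob a x)]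
  simpa using this

theorem norm_mob_sphere {a x : E4} (ha : ‖a‖ < 1) (hx : ‖x‖ = 1) : ‖mob a x‖ = 1 := by
  have h1 := norm_mob_sq (mobDen_pos (a := a) (x := x) (by rw [hx]; linarith)).ne'
  rw [hx] at h1
  have h2 : ‖mob a x‖ ^ 2 = 1 := by rw [h1]; ring
  nlinarith [norm_nonneg (mob a x)]

theorem fderivWithin_mob {a x : E4} (ha : ‖a‖ < 1) (hx : x ∈ B4) :
    fderivWithin ℝ (mob a) B4 x = fderiv ℝ (mob a) x := by
  have hu : UniqueDiffWithinAt ℝ B4 x :=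
    uniqueDiffOn_convex (convex_closedBall _ _) (by
      rw [interior_closedBall _ one_ne_zero]; exact ⟨0, by simp⟩) x hx
  exact fderivWithin_eq_fderiv hu
    ((mob_contDiffAt (mobDen_pos_of_mem ha hx).ne').differentiableAt (by simp))

theorem isConformalDiffeo_mob {a : E4} (ha : ‖a‖ < 1) : IsConformalDiffeo (mob a) := by
  have ha' : ‖-a‖ < 1 := by rwa [norm_neg]
  have hc : ∀ {a : E4}, ‖a‖ < 1 → ContDiffOn ℝ ∞ (mob a) B4 := fun ha x hx =>
    (mob_contDiffAt (mobDen_pos_of_mem ha hx).ne').contDiffWithinAt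
  have hinv : ∀ x ∈ B4, mob a (mob (-a) x) = x := fun x hx => by
    have := mob_neg_mob ha' (mobDen_pos_of_mem ha' hx).ne'
    rwa [neg_neg] at this
  refine ⟨hc ha, ⟨mob (-a), hc ha', mob_mapsTo ha', fun x hx =>
    mob_neg_mob ha (mobDen_pos_of_mem ha hx).ne', hinv⟩, mob_mapsTo ha, ?_, fun x hx => ?_⟩
  · ext y
    constructor
    · rintro ⟨x, hx, rfl⟩
      have := norm_mob_sphere ha (x := x) (by simpa using hx)
      simpa using this
    · intro hy
      have := norm_mob_sphere ha' (x := y) (by simpa using hy)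
      exact ⟨mob (-a) y, by simpa using this, hinv y (Metric.sphere_subset_closedBall hy)⟩
  · refine ⟨((1 - ‖a‖ ^ 2) / mobDen a x) ^ 2,
      pow_pos (div_pos (one_sub_sq_pos ha) (mobDen_pos_of_mem ha hx)) 2, fun v w => ?_⟩
    rw [fderivWithin_mob ha hx]
    exact inner_fderiv_mob (mobDen_pos_of_mem ha hx).ne' v w

theorem pullbackFlat_mob {a x : E4} (ha : ‖a‖ < 1) (hx : x ∈ B4) :
    pullbackFlat (mob a) x = Real.exp (2 * mobLog a x) • (1 : Matrix (Fin 4) (Fin 4) ℝ) := by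
  have hq := mobDen_pos_of_mem ha hx
  ext i j
  rw [pullbackFlat, fderivWithin_mob ha hx, inner_fderiv_mob hq.ne', ← exp_mobLog ha hq,
    ← Real.exp_nat_mul]
  simp [Matrix.one_apply, EuclideanSpace.inner_single_left]

/-- A function that is smooth on a larger ball agrees near the closed unit ball with a function
that is smooth on the whole space. -/
theorem exists_smooth_extension {f : E4 → ℝ} {R : ℝ} (hR : 1 < R)
    (hf : ∀ x, ‖x‖ < R → ContDiffAt ℝ ∞ f x) :
    ∃ g : E4 → ℝ, ContDiff ℝ ∞ g ∧ ∀ x ∈ B4, g =ᶠ[𝓝 x] f := by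
  let b : ContDiffBump (0 : E4) := ⟨(2 + R) / 3, (1 + 2 * R) / 3, by linarith, by linarith⟩
  have hin : b.rIn = (2 + R) / 3 := rfl
  have hout : b.rOut = (1 + 2 * R) / 3 := rfl
  refine ⟨fun x => b x * f x, ?_, fun x hx => ?_⟩
  · rw [contDiff_iff_contDiffAt]
    intro x
    by_cases hx : ‖x‖ < R
    · exact b.contDiff.contDiffAt.mul (hf x hx)
    · have hx' : x ∉ tsupport b := by
        rw [b.tsupport_eq, hout]; simp; linarith
      have h0 := notMem_tsupport_iff_eventuallyEq.1 hx'
      refine (contDiffAt_const (c := (0 : ℝ))).congr_of_eventuallyEq ?_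
      filter_upwards [h0] with y hy
      simp [hy]
  · have hx : ‖x‖ ≤ 1 := by simpa using hx
    have h1 : (b : E4 → ℝ) =ᶠ[𝓝 x] 1 := by
      refine b.eventuallyEq_one_of_mem_ball ?_
      rw [hin]; simp; linarith
    filter_upwards [h1] with y hy
    simp [hy]

theorem pd_congr {f g : E4 → ℝ} {x : E4} (h : f =ᶠ[𝓝 x] g) (i : Fin 4) :
    pd i f =ᶠ[𝓝 x] pd i g :=
  h.fderiv.mono fun y hy => by rw [pd, pd, hy]

theorem pd_mobDen (a x : E4) (i : Fin 4) :
    pd i (mobDen a) x = -2 * a i + 2 * ‖a‖ ^ 2 * x i := by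
  rw [pd, (hasFDerivAt_mobDen a x).fderiv]
  simp [EuclideanSpace.inner_single_right]

theorem pd_mobLog {a x : E4} (h : 0 < mobDen a x) (i : Fin 4) :
    pd i (mobLog a) x = -(-2 * a i + 2 * ‖a‖ ^ 2 * x i) / mobDen a x := by
  have hd := cd_at (mobDen_contDiff a) x
  have h1 := pd_sub (i := i) (differentiableAt_const (Real.log (1 - ‖a‖ ^ 2)))
    (hd.log h.ne')
  change pd i (mobLog a) x = _ at h1
  rw [h1, pd_const, pd_comp (φ := Real.log) (Real.hasDerivAt_log h.ne') hd, pd_mobDen]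
  ring

theorem pd_pd_mobLog {a x : E4} (h : 0 < mobDen a x) (i j : Fin 4) :
    pd j (pd i (mobLog a)) x = -(2 * ‖a‖ ^ 2 * (if j = i then 1 else 0)) / mobDen a x
      + (-2 * a i + 2 * ‖a‖ ^ 2 * x i) * (-2 * a j + 2 * ‖a‖ ^ 2 * x j) / mobDen a x ^ 2 := by
  have hev : pd i (mobLog a) =ᶠ[𝓝 x]
      fun y => (2 * a i + (-2 * ‖a‖ ^ 2) * y i) * (mobDen a y)⁻¹ := by
    have : ∀ᶠ y in 𝓝 x, 0 < mobDen a y :=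
      (mobDen_contDiff a).continuous.continuousAt.eventually (lt_mem_nhds h)
    filter_upwards [this] with y hy
    rw [pd_mobLog hy]
    ring
  have hd := cd_at (mobDen_contDiff a) x
  have hc := cd_at (coord_contDiff i) x
  rw [(pd_congr hev j).self_of_nhds, pd_mul ((hc.const_mul _).const_add _) (hd.fun_inv h.ne'),
    pd_add (differentiableAt_const _) (hc.const_mul _), pd_const, pd_const_mul, pd_coord,
    pd_comp (φ := fun t => t⁻¹) (hasDerivAt_inv h.ne') hd, pd_mobDen]
  field_simp
  ring

theorem sum_sq_mobDen (a x : E4) :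
    ∑ i, (-2 * a i + 2 * ‖a‖ ^ 2 * x i) * (-2 * a i + 2 * ‖a‖ ^ 2 * x i) =
      4 * ‖a‖ ^ 2 * mobDen a x := by
  have h1 : inner ℝ a x = ∑ i, a i * x i := by
    simp [PiLp.inner_apply, mul_comm]
  have h2 := norm_sq_eq_sum a
  have h3 := norm_sq_eq_sum x
  rw [mobDen, h1]
  generalize ‖a‖ = n at *
  rw [h3]
  simp only [Fin.sum_univ_four] at *
  linear_combination (-4) * h2

/-- Smooth functions on `ℝ⁴` that agree near the closed ball with the logarithmic conformal factor
and with the components of the Möbius translation by `a`, which for `a ≠ 0` is itself singular at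
`a / |a|²`, outside the ball. -/
structure MobExtension (a : E4) where
  /-- The logarithm of the conformal factor. -/
  w : E4 → ℝ
  /-- The components of the Möbius translation. -/
  φ : Fin 4 → E4 → ℝ
  w_smooth : ContDiff ℝ ∞ w
  φ_smooth : ∀ k, ContDiff ℝ ∞ (φ k)
  w_eq : ∀ x ∈ B4, w =ᶠ[𝓝 x] mobLog a
  φ_eq : ∀ k, ∀ x ∈ B4, φ k =ᶠ[𝓝 x] fun y => mob a y k

theorem nonempty_mobExtension {a : E4} (ha : ‖a‖ < 1) : Nonempty (MobExtension a) := by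
  have hR : 1 < 2 / (1 + ‖a‖) := by
    rw [lt_div_iff₀ (by positivity)]; linarith
  have hq : ∀ x, ‖x‖ < 2 / (1 + ‖a‖) → mobDen a x ≠ 0 := fun x hx => by
    rw [lt_div_iff₀ (by positivity)] at hx
    refine (mobDen_pos ?_).ne'
    nlinarith [norm_nonneg a, norm_nonneg x, mul_nonneg (norm_nonneg a) (norm_nonneg x)]
  obtain ⟨w, hw, hw'⟩ := exists_smooth_extension (f := mobLog a) hR fun x hx =>
    mobLog_contDiffAt (hq x hx)
  have h2 : ∀ k : Fin 4, ∃ g : E4 → ℝ, ContDiff ℝ ∞ g ∧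
      ∀ x ∈ B4, g =ᶠ[𝓝 x] fun y => mob a y k := fun k =>
    exists_smooth_extension hR fun x hx =>
      (coord_contDiff k).contDiffAt.comp x (mob_contDiffAt (hq x hx))
  choose φ hφ hφ' using h2
  exact ⟨⟨w, φ, hw, hφ, hw', hφ'⟩⟩

namespace MobExtension

variable {a : E4} (e : MobExtension a)

theorem pd_w {x : E4} (ha : ‖a‖ < 1) (hx : x ∈ B4) (i : Fin 4) :
    pd i e.w x = -(-2 * a i + 2 * ‖a‖ ^ 2 * x i) / mobDen a x := by
  rw [(pd_congr (e.w_eq x hx) i).self_of_nhds, pd_mobLog (mobDen_pos_of_mem ha hx)]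

/-- `e^{2w} dx²` is flat, being the pullback of `dx²`. -/
theorem schoutenFlat_w {x : E4} (ha : ‖a‖ < 1) (hx : x ∈ B4) (i j : Fin 4) :
    schoutenFlat e.w i j x = 0 := by
  have hq := mobDen_pos_of_mem ha hx
  have hg : gdot e.w e.w x = 4 * ‖a‖ ^ 2 / mobDen a x := by
    have : ∀ i, pd i e.w x * pd i e.w x =
        (-2 * a i + 2 * ‖a‖ ^ 2 * x i) * (-2 * a i + 2 * ‖a‖ ^ 2 * x i) / mobDen a x ^ 2 :=
      fun i => by rw [e.pd_w ha hx]; field_simp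
    simp only [gdot, this, ← Finset.sum_div, sum_sq_mobDen]
    field_simp
  rw [schoutenFlat, (pd_congr (pd_congr (e.w_eq x hx) j) i).self_of_nhds, pd_pd_mobLog hq, hg,
    e.pd_w ha hx, e.pd_w ha hx]
  split_ifs <;> field_simp <;> ring

theorem lap_w {x : E4} (ha : ‖a‖ < 1) (hx : x ∈ B4) : lap e.w x = -gdot e.w e.w x := by
  have h := sum_schoutenFlat_diag e.w x
  simp only [e.schoutenFlat_w ha hx, Finset.sum_const_zero] at h
  linarith

/-- The mean curvature of `S³` for `e^{2w} dx²` is one. -/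
theorem rad_w (ha : ‖a‖ < 1) (ξ : S3) : 1 + rad e.w ξ = Real.exp (e.w ξ) := by
  have hx : (ξ : E4) ∈ B4 := Metric.sphere_subset_closedBall ξ.2
  have hq := mobDen_pos_of_mem ha hx
  have hn := sum_sq_sphere ξ
  have h1 : inner ℝ a (ξ : E4) = ∑ i, a i * (ξ : E4) i := by
    simp [PiLp.inner_apply, mul_comm]
  rw [(e.w_eq _ hx).self_of_nhds, exp_mobLog ha hq]
  simp only [rad, e.pd_w ha hx]
  have h2 : ∑ i, (ξ : E4) i * (-(-2 * a i + 2 * ‖a‖ ^ 2 * (ξ : E4) i) / mobDen a ξ) =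
      (2 * inner ℝ a (ξ : E4) - 2 * ‖a‖ ^ 2) / mobDen a ξ := by
    rw [h1]
    simp only [Fin.sum_univ_four] at *
    field_simp
    linear_combination (-‖a‖ ^ 2) * hn
  rw [h2]
  field_simp
  rw [mobDen]
  simp
  ring

theorem sum_pd_φ {x : E4} (ha : ‖a‖ < 1) (hx : x ∈ B4) (i j : Fin 4) :
    ∑ k, pd i (e.φ k) x * pd j (e.φ k) x = if i = j then Real.exp (e.w x) ^ 2 else 0 := by
  have hq := mobDen_pos_of_mem ha hx
  have h1 : ∀ i k, pd i (e.φ k) x = (fderiv ℝ (mob a) x (EuclideanSpace.single i 1)) k := by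
    intro i k
    rw [(pd_congr (e.φ_eq k x hx) i).self_of_nhds, pd]
    have hd := (mob_contDiffAt hq.ne').differentiableAt (by simp)
    have h : HasFDerivAt (fun y => mob a y k) _ x :=
      (EuclideanSpace.proj k : E4 →L[ℝ] ℝ).hasFDerivAt.comp x hd.hasFDerivAt
    rw [h.fderiv]
    simp
  have h2 := inner_fderiv_mob hq.ne' (EuclideanSpace.single i (1 : ℝ)) (EuclideanSpace.single j 1)
  rw [(e.w_eq x hx).self_of_nhds, exp_mobLog ha hq]
  simp only [h1]
  rw [PiLp.inner_apply] at h2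
  simp only [RCLike.inner_apply, conj_trivial, EuclideanSpace.inner_single_left] at h2
  rw [Finset.sum_congr rfl fun k _ => mul_comm _ _, h2]
  by_cases hij : i = j <;> simp [hij]

theorem sum_φ_sq (ha : ‖a‖ < 1) (ξ : S3) : ∑ k, e.φ k ξ ^ 2 = 1 := by
  have hx : (ξ : E4) ∈ B4 := Metric.sphere_subset_closedBall ξ.2
  have h := norm_sq_eq_sum (mob a ξ)
  rw [norm_mob_sphere ha (by simp)] at h
  rw [Finset.sum_congr rfl fun k _ => by rw [(e.φ_eq k _ hx).self_of_nhds, sq], ← h, one_pow]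

/-- The boundary volume of the pullback of `dx²` is `ω₃`. As `e^{2w} dx²` has `σ₂ = 0` and
`H₂ = 1`, this is the invariance of the total curvature. -/
theorem integral_exp_w (ha : ‖a‖ < 1) : ∫ ξ : S3, Real.exp (e.w ξ) ^ 3 ∂surf = omega3 := by
  have h := total_curvature e.w_smooth
  have h1 : ∫ x in B4, sigmaDens e.w x = 0 := by
    rw [setIntegral_congr_fun (g := fun _ => 0) measurableSet_closedBall fun x hx => by
      simp [sigmaDens, e.schoutenFlat_w ha hx]]
    simp
  have h2 : ∀ ξ : S3, bdryH2Dens e.w ξ = Real.exp (e.w ξ) ^ 3 := fun ξ => by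
    have hx : (ξ : E4) ∈ B4 := Metric.sphere_subset_closedBall ξ.2
    simp [bdryH2Dens, e.schoutenFlat_w ha hx, e.rad_w ha]
  rw [h1, zero_add] at h
  simpa only [h2] using h

/-- The flux of `∇w` is nonpositive, because `Δw = -|∇w|²`, and on `S³` one has `w_r = e^w - 1`. -/
theorem integral_exp_w_le (ha : ‖a‖ < 1) : ∫ ξ : S3, Real.exp (e.w ξ) ∂surf ≤ omega3 := by
  have h := integral_ball_div (X := fun i => pd i e.w) fun i => pd_contDiff e.w_smooth i
  have h1 : ∫ x in B4, ∑ i, pd i (pd i e.w) x ≤ 0 := by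
    refine setIntegral_nonpos measurableSet_closedBall fun x hx => ?_
    change lap e.w x ≤ 0
    rw [e.lap_w ha hx, neg_nonpos]
    exact Finset.sum_nonneg fun i _ => mul_self_nonneg _
  have h2 : ∀ ξ : S3, ∑ i, pd i e.w ξ * (ξ : E4) i = Real.exp (e.w ξ) - 1 := fun ξ => by
    rw [← e.rad_w ha, rad, add_sub_cancel_left]
    exact Finset.sum_congr rfl fun i _ => mul_comm _ _
  rw [h] at h1
  simp only [h2] at h1
  rw [integral_sub (integrable_surf (f := fun x => Real.exp (e.w x))
    (Real.continuous_exp.comp e.w_smooth.continuous)) (integrable_const _)] at h1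
  have h3 : ∫ _ : S3, (1 : ℝ) ∂surf = omega3 := by simp [omega3]
  linarith

end MobExtension

/-! ### Conformal barycenters -/

/-- The functional on the ball whose critical points are the conformal barycenters of the measure
`e^{3u} dσ` on `S³`. -/
def barycenterFn (u : E4 → ℝ) (a : E4) : ℝ := ∫ ξ : S3, mobLog a ξ * Real.exp (3 * u ξ) ∂surf

theorem hasFDerivAt_mobLog_left {a x : E4} (ha : ‖a‖ < 1) (h : 0 < mobDen a x) :
    HasFDerivAt (fun b => mobLog b x) ((-2 / (1 - ‖a‖ ^ 2)) • innerSL ℝ a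
      - (mobDen a x)⁻¹ • ((-2 : ℝ) • innerSL ℝ x + (2 * ‖x‖ ^ 2) • innerSL ℝ a)) a := by
  have h1 : HasFDerivAt (fun x : E4 => ‖x‖ ^ 2) (2 • innerSL ℝ a) a :=
    (hasStrictFDerivAt_norm_sq a).hasFDerivAt
  have h2 : HasFDerivAt (fun b => mobDen b x)
      ((-2 : ℝ) • innerSL ℝ x + (2 * ‖x‖ ^ 2) • innerSL ℝ a) a := by
    have := hasFDerivAt_mobDen x a
    have e : mobDen x = fun b => mobDen b x := by
      ext b; rw [mobDen, mobDen, real_inner_comm]; ring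
    rwa [e] at this
  have h3 := ((h1.const_sub 1).log (one_sub_sq_pos ha).ne').sub (h2.log h.ne')
  refine h3.congr_fderiv ?_
  ext v
  simp
  ring

theorem hasFDerivAt_barycenterFn {u : E4 → ℝ} (hu : Continuous u) {a : E4} (ha : ‖a‖ < 1) :
    HasFDerivAt (barycenterFn u) (∫ ξ : S3, Real.exp (3 * u ξ) • ((-2 / (1 - ‖a‖ ^ 2)) • innerSL ℝ a
      - (mobDen a ξ)⁻¹ • ((-2 : ℝ) • innerSL ℝ (ξ : E4)
        + (2 * ‖(ξ : E4)‖ ^ 2) • innerSL ℝ a)) ∂surf) a := by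
  have hq : ∀ b ∈ Metric.ball (0 : E4) 1, ∀ ξ ∈ S3, 0 < mobDen b ξ := fun b hb ξ hξ =>
    mobDen_pos_of_mem (by simpa using hb) (Metric.sphere_subset_closedBall hξ)
  refine hasFDerivAt_integral_sphere (F := fun b ξ => mobLog b ξ * Real.exp (3 * u ξ))
    (F' := fun b ξ => Real.exp (3 * u ξ) • ((-2 / (1 - ‖b‖ ^ 2)) • innerSL ℝ b
      - (mobDen b ξ)⁻¹ • ((-2 : ℝ) • innerSL ℝ ξ + (2 * ‖ξ‖ ^ 2) • innerSL ℝ b)))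
    (U := Metric.ball 0 1) Metric.isOpen_ball (fun b hb ξ hξ => ?_) (fun b hb ξ hξ => ?_)
    (fun b hb ξ hξ => ?_) surf (by simpa using ha)
  · exact ((mobLog_contDiffAt (hq b hb ξ hξ).ne').continuousAt.mul
      (by fun_prop)).continuousWithinAt
  · exact (hasFDerivAt_mobLog_left (by simpa using hb) (hq b hb ξ hξ)).mul_const _
  · have hb' : 1 - ‖b‖ ^ 2 ≠ 0 := (one_sub_sq_pos (by simpa using hb)).ne'
    have hqc : ContinuousAt (fun p : E4 × E4 => mobDen p.1 p.2) (b, ξ) := by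
      unfold mobDen; fun_prop
    have c1 : ContinuousAt (fun p : E4 × E4 => (mobDen p.1 p.2)⁻¹) (b, ξ) :=
      hqc.inv₀ (hq b hb ξ hξ).ne'
    have c2 : ContinuousAt (fun p : E4 × E4 => -2 / (1 - ‖p.1‖ ^ 2)) (b, ξ) :=
      ContinuousAt.div (by fun_prop) (by fun_prop) hb'
    have c0 : Continuous fun p : E4 × E4 => Real.exp (3 * u p.2) := by fun_prop
    have c3 : Continuous fun p : E4 × E4 => innerSL ℝ p.1 := by fun_prop
    have c4 : Continuous fun p : E4 × E4 =>
        (-2 : ℝ) • innerSL ℝ p.2 + (2 * ‖p.2‖ ^ 2) • innerSL ℝ p.1 := by fun_prop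
    exact c0.continuousAt.smul ((c2.smul c3.continuousAt).sub (c1.smul c4.continuousAt))

/-- The pointwise bound behind the coercivity of `barycenterFn`: with the weight
`θ = (1 - ⟨a, ξ⟩) / 2`, the logarithmic pole of `mobLog` is cancelled in `θ w`, and
`(1 - θ) w ≤ e^w`. -/
theorem mobLog_le {a : E4} (ha : ‖a‖ < 1) (ξ : S3) :
    mobLog a ξ ≤ Real.exp (mobLog a ξ)
      + (1 - inner ℝ a (ξ : E4)) / 2 * Real.log (1 - ‖a‖ ^ 2) + 1 := by
  have hξ : ‖(ξ : E4)‖ = 1 := by simp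
  have hq := mobDen_pos_of_mem ha (Metric.sphere_subset_closedBall ξ.2)
  have hs := abs_le.1 (abs_real_inner_le_norm a (ξ : E4))
  rw [hξ, mul_one] at hs
  have hden : mobDen a ξ = 1 - 2 * inner ℝ a (ξ : E4) + ‖a‖ ^ 2 := by
    rw [mobDen, hξ]; ring
  set s := inner ℝ a (ξ : E4)
  set w := mobLog a ξ with hw
  have hx : 0 < 1 - s := by linarith
  have h1 : 2 * Real.log (1 - s) ≤ Real.log (mobDen a ξ) := by
    rw [← Real.log_rpow hx]
    refine Real.log_le_log (by positivity) ?_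
    rw [hden]; norm_num
    nlinarith
  have h2 : 1 - (1 - s)⁻¹ ≤ Real.log (1 - s) := Real.one_sub_inv_le_log_of_pos hx
  have h3 : (1 - s) * (1 - (1 - s)⁻¹) ≤ (1 - s) * Real.log (1 - s) :=
    mul_le_mul_of_nonneg_left h2 hx.le
  have h4 : (1 - s) * (1 - (1 - s)⁻¹) = -s := by field_simp; ring
  have h5 : (1 - s) / 2 * w ≤ (1 - s) / 2 * Real.log (1 - ‖a‖ ^ 2) + s := by
    have : (1 - s) / 2 * (2 * Real.log (1 - s)) ≤ (1 - s) / 2 * Real.log (mobDen a ξ) :=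
      mul_le_mul_of_nonneg_left h1 (by linarith)
    rw [hw, mobLog, mul_sub]
    linarith
  have h6 : w ≤ Real.exp w := by linarith [Real.add_one_le_exp w]
  have h7 : (1 - (1 - s) / 2) * w ≤ (1 - (1 - s) / 2) * Real.exp w :=
    mul_le_mul_of_nonneg_left h6 (by linarith)
  have h8 : (1 - (1 - s) / 2) * Real.exp w ≤ 1 * Real.exp w :=
    mul_le_mul_of_nonneg_right (by linarith) (Real.exp_pos w).le
  linarith

theorem integral_sphere_inner (a : E4) : ∫ ξ : S3, inner ℝ a (ξ : E4) ∂surf = 0 := by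
  have h : ∀ i : Fin 4, ∫ ξ : S3, (ξ : E4) i ∂surf = 0 := fun i => by
    have := integral_ball_pd (contDiff_const (c := (1 : ℝ))) i
    simpa [pd_const] using this.symm
  have e : ∀ ξ : S3, inner ℝ a (ξ : E4) = ∑ i, a i * (ξ : E4) i := fun ξ => by
    simp [PiLp.inner_apply, mul_comm]
  simp only [e]
  rw [integral_finsetSum _ fun i _ => integrable_surf (f := fun x => a i * x i) (by fun_prop)]
  simp only [integral_const_mul, h, mul_zero, Finset.sum_const_zero]

/-- `barycenterFn` tends to `-∞` at the boundary of the ball, since `log (1 - |a|²)` does. -/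
theorem barycenterFn_le {u : E4 → ℝ} (hu : Continuous u) : ∃ C c : ℝ, 0 < c ∧
    ∀ a : E4, ‖a‖ < 1 → barycenterFn u a ≤ C + c * Real.log (1 - ‖a‖ ^ 2) := by
  have hω := omega3_pos
  have hS : IsCompact S3 := isCompact_sphere _ _
  have hne : S3.Nonempty := NormedSpace.sphere_nonempty.2 zero_le_one
  have hρ : Continuous fun x => Real.exp (3 * u x) := by fun_prop
  obtain ⟨x0, _, h0⟩ := hS.exists_isMinOn hne hρ.continuousOn
  obtain ⟨x1, _, h1⟩ := hS.exists_isMaxOn hne hρ.continuousOn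
  set m := Real.exp (3 * u x0) with hm
  set K := Real.exp (3 * u x1) with hK
  have hmpos : 0 < m := Real.exp_pos _
  have hKpos : 0 < K := Real.exp_pos _
  refine ⟨K * omega3 + ∫ ξ : S3, Real.exp (3 * u ξ) ∂surf, m * (omega3 / 2), by positivity,
    fun a ha => ?_⟩
  obtain ⟨e⟩ := nonempty_mobExtension ha
  have hwe : ∀ ξ : S3, mobLog a ξ = e.w ξ := fun ξ =>
    ((e.w_eq _ (Metric.sphere_subset_closedBall ξ.2)).self_of_nhds).symm
  have hL : Real.log (1 - ‖a‖ ^ 2) ≤ 0 :=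
    Real.log_nonpos (one_sub_sq_pos ha).le (by nlinarith [norm_nonneg a])
  set L := Real.log (1 - ‖a‖ ^ 2) with hLd
  have hwc : Continuous e.w := e.w_smooth.continuous
  have hb : ∀ ξ : S3, mobLog a ξ * Real.exp (3 * u ξ) ≤ K * Real.exp (e.w ξ)
      + (m * L / 2 - m * L / 2 * inner ℝ a (ξ : E4)) + Real.exp (3 * u ξ) := by
    intro ξ
    have k1 := mul_le_mul_of_nonneg_right (mobLog_le ha ξ) (Real.exp_pos (3 * u ξ)).le
    rw [hwe] at k1 ⊢
    have k2 : m ≤ Real.exp (3 * u ξ) := h0 ξ.2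
    have k3 : Real.exp (3 * u ξ) ≤ K := h1 ξ.2
    have hs := abs_le.1 (abs_real_inner_le_norm a (ξ : E4))
    rw [show ‖(ξ : E4)‖ = 1 by simp, mul_one] at hs
    have k4 : 0 ≤ (1 - inner ℝ a (ξ : E4)) / 2 * -L :=
      mul_nonneg (by linarith) (by linarith)
    have k5 := mul_le_mul_of_nonneg_left k2 k4
    have k6 := mul_le_mul_of_nonneg_left k3 (Real.exp_pos (e.w ξ)).le
    linarith
  have i1 := integrable_surf (f := fun x => K * Real.exp (e.w x)) (by fun_prop)
  have i2 := integrable_surf (f := fun x => m * L / 2 * inner ℝ a x) (by fun_prop)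
  have i3 := integrable_surf hρ
  have i4 := integrable_surf (f := fun x => e.w x * Real.exp (3 * u x)) (by fun_prop)
  have i5 : Integrable (fun _ : S3 => m * L / 2) surf := integrable_const _
  have hi : barycenterFn u a = ∫ ξ : S3, e.w ξ * Real.exp (3 * u ξ) ∂surf := by
    simp only [barycenterFn, hwe]
  rw [hi]
  simp only [hwe] at hb
  refine (integral_mono i4 ((i1.fun_add (integrable_fun_sub i5 i2)).fun_add i3) hb).trans ?_
  rw [integral_add (i1.fun_add (integrable_fun_sub i5 i2)) i3,
    integral_add i1 (integrable_fun_sub i5 i2), integral_sub i5 i2, integral_const_mul,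
    integral_const_mul, integral_sphere_inner]
  have hc : ∫ _ : S3, m * L / 2 ∂surf = m * L / 2 * omega3 := by simp [omega3, mul_comm]
  rw [hc]
  have := mul_le_mul_of_nonneg_left (e.integral_exp_w_le ha) hKpos.le
  linarith

/-- Every measure `e^{3u} dσ` on `S³` is balanced by a Möbius translation: `barycenterFn` attains
its maximum in the open ball, and its gradient at `a` is a multiple of the integral of the vector
`mob a ξ`. -/
theorem exists_conformal_barycenter {u : E4 → ℝ} (hu : Continuous u) :
    ∃ a : E4, ‖a‖ < 1 ∧ ∀ k : Fin 4, ∫ ξ : S3, mob a ξ k * Real.exp (3 * u ξ) ∂surf = 0 := by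
  obtain ⟨C, c, hc, hle⟩ := barycenterFn_le hu
  -- on the sphere of radius `R` the functional is below its value `0` at the origin
  set T := (|C| + 1) / c with hT
  have hTpos : 0 < T := by positivity
  set R := √(1 - Real.exp (-T)) with hR
  have hexp1 : Real.exp (-T) < 1 := by
    have := Real.exp_lt_exp.2 (show -T < 0 by linarith)
    rwa [Real.exp_zero] at this
  have hR2 : R ^ 2 = 1 - Real.exp (-T) := Real.sq_sqrt (by linarith)
  have hR0 : 0 < R := Real.sqrt_pos.2 (by linarith)
  have hR1 : R < 1 := by nlinarith [Real.exp_pos (-T)]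
  have hlow : ∀ a : E4, ‖a‖ = R → barycenterFn u a < 0 := by
    intro a ha
    have h := hle a (by rw [ha]; exact hR1)
    have e1 : 1 - ‖a‖ ^ 2 = Real.exp (-T) := by rw [ha, hR2]; ring
    have e2 : c * -T = -(|C| + 1) := by rw [hT]; field_simp
    rw [e1, Real.log_exp, e2] at h
    linarith [le_abs_self C]
  have h0 : barycenterFn u 0 = 0 := by simp [barycenterFn, mobLog, mobDen]
  have hcont : ContinuousOn (barycenterFn u) (Metric.closedBall 0 R) := fun a ha =>
    (hasFDerivAt_barycenterFn hu (lt_of_le_of_lt (by simpa using ha) hR1)).continuousAt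
      |>.continuousWithinAt
  obtain ⟨a, haR, hmax⟩ := (isCompact_closedBall (0 : E4) R).exists_isMaxOn
    ⟨0, by simpa using hR0.le⟩ hcont
  have haR' : ‖a‖ ≤ R := by simpa using haR
  have hlt : ‖a‖ < R := by
    refine lt_of_le_of_ne haR' fun h => ?_
    have h1 : barycenterFn u 0 ≤ barycenterFn u a := hmax (by simpa using hR0.le)
    have h2 := hlow a h
    linarith
  have ha1 : ‖a‖ < 1 := hlt.trans hR1
  have hloc : IsLocalMax (barycenterFn u) a :=
    hmax.isLocalMax (Filter.mem_of_superset (Metric.isOpen_ball.mem_nhds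
      (by simpa using hlt : a ∈ Metric.ball (0 : E4) R)) Metric.ball_subset_closedBall)
  have hz := hloc.hasFDerivAt_eq_zero (hasFDerivAt_barycenterFn hu ha1)
  refine ⟨a, ha1, fun k => ?_⟩
  have hq : ∀ ξ : S3, 0 < mobDen a ξ := fun ξ =>
    mobDen_pos_of_mem ha1 (Metric.sphere_subset_closedBall ξ.2)
  have hα := one_sub_sq_pos ha1
  have hcS : Continuous fun ξ : S3 => Real.exp (3 * u ξ) • ((-2 / (1 - ‖a‖ ^ 2)) • innerSL ℝ a
      - (mobDen a ξ)⁻¹ • ((-2 : ℝ) • innerSL ℝ (ξ : E4)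
        + (2 * ‖(ξ : E4)‖ ^ 2) • innerSL ℝ a)) := by
    have c1 : Continuous fun ξ : S3 => (mobDen a ξ)⁻¹ :=
      ((mobDen_contDiff a).continuous.comp continuous_subtype_val).inv₀ fun ξ => (hq ξ).ne'
    fun_prop
  have hint := hcS.integrable_of_hasCompactSupport (μ := surf) (HasCompactSupport.of_compactSpace _)
  have h1 := congrArg (fun Lm : E4 →L[ℝ] ℝ => Lm (EuclideanSpace.single k 1)) hz
  rw [ContinuousLinearMap.integral_apply hint] at h1
  have h2 : ∀ ξ : S3, mob a ξ k * Real.exp (3 * u ξ) = (1 - ‖a‖ ^ 2) / 2 *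
      ((Real.exp (3 * u ξ) • ((-2 / (1 - ‖a‖ ^ 2)) • innerSL ℝ a
      - (mobDen a ξ)⁻¹ • ((-2 : ℝ) • innerSL ℝ (ξ : E4)
        + (2 * ‖(ξ : E4)‖ ^ 2) • innerSL ℝ a))) (EuclideanSpace.single k 1)) := by
    intro ξ
    have := (hq ξ).ne'
    simp [mob, EuclideanSpace.inner_single_right]
    field_simp
    ring
  simp only [h2, integral_const_mul, h1]
  simp

/-! ### Rigidity -/

namespace MobExtension

variable {a : E4} (e : MobExtension a)

/-- The sum of the second variations in the directions of the four components of a Möbius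
translation. As `∑ₖ ∂ᵢφₖ ∂ⱼφₖ = e^{2w} δᵢⱼ`, only the trace `-3 (Δu + |∇u|²)` of the Newton tensor
enters. -/
theorem sum_secondVariation (ha : ‖a‖ < 1) {u : E4 → ℝ} (hu : ContDiff ℝ ∞ u) :
    ∑ k, secondVariation u (e.φ k) =
      3 * ((∫ ξ : S3, (1 + rad u ξ) * Real.exp (e.w ξ) ^ 2 ∂surf)
        - ∫ x in B4, Real.exp (e.w x) ^ 2 * (lap u x + gdot u u x)) := by
  have hφ := e.φ_smooth
  have cB : ∀ k ∈ Finset.univ, IntegrableOn (fun x => hess u (e.φ k) (e.φ k) x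
      - lap u x * gdot (e.φ k) (e.φ k) x - gdot u (e.φ k) x ^ 2
      - gdot u u x * gdot (e.φ k) (e.φ k) x / 2) B4 := by
    intro k _
    have h1 := (hess_contDiff hu (hφ k) (hφ k)).continuous
    have h2 := (lap_contDiff hu).continuous
    have h3 := (gdot_contDiff (hφ k) (hφ k)).continuous
    have h4 := (gdot_contDiff hu (hφ k)).continuous
    have h5 := (gdot_contDiff hu hu).continuous
    exact integrable_ball (by fun_prop)
  have cS : ∀ k ∈ Finset.univ, Integrable (fun ξ : S3 =>
      (1 + rad u ξ) * tdot (e.φ k) (e.φ k) ξ) surf := by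
    intro k _
    have h1 := (rad_contDiff hu).continuous
    have h2 := (tdot_contDiff (hφ k) (hφ k)).continuous
    exact integrable_surf (f := fun x => (1 + rad u x) * tdot (e.φ k) (e.φ k) x) (by fun_prop)
  simp only [secondVariation, Finset.sum_add_distrib]
  rw [← integral_finsetSum _ cB, ← integral_finsetSum _ cS]
  -- pointwise, `∑ₖ ∂ᵢφₖ ∂ⱼφₖ = e^{2w} δᵢⱼ`
  have gsum : ∀ x ∈ B4, ∑ k, gdot (e.φ k) (e.φ k) x = 4 * Real.exp (e.w x) ^ 2 := by
    intro x hx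
    simp only [gdot]
    rw [Finset.sum_comm]
    simp [e.sum_pd_φ ha hx]
  have eB : ∀ x ∈ B4, ∑ k, (hess u (e.φ k) (e.φ k) x
      - lap u x * gdot (e.φ k) (e.φ k) x - gdot u (e.φ k) x ^ 2
      - gdot u u x * gdot (e.φ k) (e.φ k) x / 2) =
      -3 * (Real.exp (e.w x) ^ 2 * (lap u x + gdot u u x)) := by
    intro x hx
    have h1 : ∑ k, hess u (e.φ k) (e.φ k) x = Real.exp (e.w x) ^ 2 * lap u x := by
      simp only [hess, mul_assoc]
      rw [Finset.sum_comm, lap, Finset.mul_sum]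
      refine Finset.sum_congr rfl fun i _ => ?_
      rw [Finset.sum_comm]
      simp only [← Finset.mul_sum, e.sum_pd_φ ha hx]
      simp [mul_comm]
    have h2 : ∑ k, gdot u (e.φ k) x ^ 2 = Real.exp (e.w x) ^ 2 * gdot u u x := by
      have : ∀ k, gdot u (e.φ k) x ^ 2 = ∑ i, ∑ j,
          (pd i u x * pd j u x) * (pd i (e.φ k) x * pd j (e.φ k) x) := fun k => by
        rw [sq, gdot, Finset.sum_mul_sum]
        exact Finset.sum_congr rfl fun i _ => Finset.sum_congr rfl fun j _ => by ring
      simp only [this]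
      rw [Finset.sum_comm, gdot, Finset.mul_sum]
      refine Finset.sum_congr rfl fun i _ => ?_
      rw [Finset.sum_comm]
      simp only [← Finset.mul_sum, e.sum_pd_φ ha hx]
      simp [mul_comm]
    simp only [Finset.sum_sub_distrib, ← Finset.mul_sum, ← Finset.sum_div, h1, h2, gsum x hx]
    ring
  have eS : ∀ ξ : S3, ∑ k, (1 + rad u ξ) * tdot (e.φ k) (e.φ k) ξ =
      3 * ((1 + rad u ξ) * Real.exp (e.w ξ) ^ 2) := by
    intro ξ
    have hx : (ξ : E4) ∈ B4 := Metric.sphere_subset_closedBall ξ.2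
    have h1 : ∑ k, rad (e.φ k) ξ * rad (e.φ k) ξ = Real.exp (e.w ξ) ^ 2 := by
      have : ∀ k, rad (e.φ k) ξ * rad (e.φ k) ξ = ∑ i, ∑ j,
          ((ξ : E4) i * (ξ : E4) j) * (pd i (e.φ k) ξ * pd j (e.φ k) ξ) := fun k => by
        rw [rad, Finset.sum_mul_sum]
        exact Finset.sum_congr rfl fun i _ => Finset.sum_congr rfl fun j _ => by ring
      simp only [this]
      rw [Finset.sum_comm, ← mul_one (Real.exp (e.w ξ) ^ 2), ← sum_sq_sphere ξ, Finset.mul_sum]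
      refine Finset.sum_congr rfl fun i _ => ?_
      rw [Finset.sum_comm]
      simp only [← Finset.mul_sum, e.sum_pd_φ ha hx]
      simp [mul_comm]
    simp only [← Finset.mul_sum, tdot, Finset.sum_sub_distrib, gsum _ hx, h1]
    ring
  rw [setIntegral_congr_fun measurableSet_closedBall eB, integral_const_mul]
  simp only [eS, integral_const_mul]
  ring

/-- In the variable `z = u - w`, the right side of `sum_secondVariation` is
`ω₃ - ∫ e^{2w} |∇z|²`. -/
theorem integral_newton_trace (ha : ‖a‖ < 1) {u : E4 → ℝ} (hu : ContDiff ℝ ∞ u) :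
    (∫ ξ : S3, (1 + rad u ξ) * Real.exp (e.w ξ) ^ 2 ∂surf)
        - (∫ x in B4, Real.exp (e.w x) ^ 2 * (lap u x + gdot u u x)) =
      omega3 - ∫ x in B4, Real.exp (e.w x) ^ 2
        * gdot (fun y => u y - e.w y) (fun y => u y - e.w y) x := by
  have hw := e.w_smooth
  set z : E4 → ℝ := fun y => u y - e.w y with hz
  have hzs : ContDiff ℝ ∞ z := hu.sub hw
  set E : E4 → ℝ := fun x => Real.exp (2 * e.w x) with hE
  have hEs : ContDiff ℝ ∞ E := (contDiff_const.mul hw).exp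
  have hEe : ∀ x, Real.exp (e.w x) ^ 2 = E x := fun x => by
    rw [hE, ← Real.exp_nat_mul]; norm_num
  have pz : ∀ i, pd i z = fun x => pd i u x - pd i e.w x := fun i => funext fun x =>
    pd_sub (cd_at hu x) (cd_at hw x) i
  have ppz : ∀ i j x, pd j (pd i z) x = pd j (pd i u) x - pd j (pd i e.w) x := fun i j x => by
    rw [pz, pd_sub (cd_at (pd_contDiff hu i) x) (cd_at (pd_contDiff hw i) x)]
  have hX : ∀ i, ContDiff ℝ ∞ fun x => E x * pd i z x := fun i => hEs.mul (pd_contDiff hzs i)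
  have hdiv := integral_ball_div hX
  have pE : ∀ i x, pd i E x = 2 * pd i e.w x * E x := fun i x => by
    rw [hE, pd_comp (φ := Real.exp) (f := fun y => 2 * e.w y) (Real.hasDerivAt_exp _)
      ((cd_at hw x).const_mul 2), pd_const_mul]
    ring
  have h1 : ∀ x ∈ B4, ∑ i, pd i (fun x => E x * pd i z x) x =
      E x * (lap u x + gdot u u x) - E x * gdot z z x := by
    intro x hx
    have hl := e.lap_w ha hx
    have : ∀ i, pd i (fun x => E x * pd i z x) x =
        2 * pd i e.w x * E x * pd i z x + E x * pd i (pd i z) x := fun i => by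
      rw [pd_mul (cd_at hEs x) (cd_at (pd_contDiff hzs i) x), pE]
    simp only [this, ppz]
    simp only [pz, gdot, lap, Fin.sum_univ_four] at hl ⊢
    linear_combination (-E x) * hl
  have c1 : Continuous fun x => E x * (lap u x + gdot u u x) :=
    hEs.continuous.mul ((lap_contDiff hu).continuous.add (gdot_contDiff hu hu).continuous)
  have c2 : Continuous fun x => E x * gdot z z x :=
    hEs.continuous.mul (gdot_contDiff hzs hzs).continuous
  rw [setIntegral_congr_fun measurableSet_closedBall h1,
    integral_sub (integrable_ball c1) (integrable_ball c2)] at hdiv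
  have c3 : Continuous fun x => (1 + rad u x) * E x :=
    (continuous_const.add (rad_contDiff hu).continuous).mul hEs.continuous
  have c4 : Continuous fun x => ∑ i, E x * pd i z x * x i :=
    continuous_finsetSum _ fun i _ => (hX i).continuous.mul (coord_contDiff i).continuous
  have h2 : (∫ ξ : S3, (1 + rad u ξ) * E ξ ∂surf)
      - (∫ ξ : S3, ∑ i, E ξ * pd i z ξ * (ξ : E4) i ∂surf) = omega3 := by
    rw [← integral_sub (integrable_surf c3) (integrable_surf c4), ← e.integral_exp_w ha]
    congr 1; ext ξ
    have hr := e.rad_w ha ξ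
    rw [pow_succ, ← hr, pow_two]
    have hE' := hEe ξ
    rw [← hr, pow_two] at hE'
    rw [← hr] at *
    simp only [← hE', pz, rad, Fin.sum_univ_four]
    ring
  simp only [hEe]
  linarith

end MobExtension

/-- A function minimizing `𝒢₂` to second order along lines is, up to a constant, the logarithmic
conformal factor of a Möbius translation: the inequalities `secondVariation_ge` for the balanced
components `φₖ` add up to `3 ω₃ ≤ 3 (ω₃ - ∫ e^{2w} |∇(u - w)|²)`. -/
theorem eq_mobLog_add_const {u : E4 → ℝ} (hu : ContDiff ℝ ∞ u) (hmin : IsAffineMin u) :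
    ∃ a : E4, ‖a‖ < 1 ∧ ∃ c : ℝ, ∀ x ∈ B4, u x = mobLog a x + c := by
  obtain ⟨a, ha, hbal⟩ := exists_conformal_barycenter hu.continuous
  obtain ⟨e⟩ := nonempty_mobExtension ha
  have huc := hu.continuous
  have hSB : ∀ ξ : S3, (ξ : E4) ∈ B4 := fun ξ => Metric.sphere_subset_closedBall ξ.2
  have hbal' : ∀ k, ∫ ξ : S3, e.φ k ξ * Real.exp (3 * u ξ) ∂surf = 0 := fun k => by
    rw [← hbal k]
    congr 1; ext ξ
    rw [(e.φ_eq k _ (hSB ξ)).self_of_nhds]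
  have hsv := Finset.sum_le_sum fun k (_ : k ∈ Finset.univ) =>
    secondVariation_ge hu (e.φ_smooth k) hmin (hbal' k)
  set M := ∫ ξ : S3, Real.exp (3 * u ξ) ∂surf with hM
  have hMpos : 0 < M := sphere_integral_exp_pos (u := fun x => 3 * u x) (by fun_prop)
  have hsum : ∑ k, ∫ ξ : S3, e.φ k ξ ^ 2 * Real.exp (3 * u ξ) ∂surf = M := by
    rw [← integral_finsetSum]
    · congr 1; ext ξ
      rw [← Finset.sum_mul, e.sum_φ_sq ha, one_mul]
    · intro k _
      have := (e.φ_smooth k).continuous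
      exact integrable_surf (f := fun x => e.φ k x ^ 2 * Real.exp (3 * u x)) (by fun_prop)
  rw [← Finset.mul_sum, hsum, div_mul_cancel₀ _ hMpos.ne', e.sum_secondVariation ha hu,
    e.integral_newton_trace ha hu] at hsv
  set z : E4 → ℝ := fun y => u y - e.w y with hz
  have hzs : ContDiff ℝ ∞ z := hu.sub e.w_smooth
  have hgc : Continuous fun x => Real.exp (e.w x) ^ 2 * gdot z z x :=
    ((Real.continuous_exp.comp e.w_smooth.continuous).pow 2).mul
      (gdot_contDiff hzs hzs).continuous
  have hnn : ∀ x, 0 ≤ Real.exp (e.w x) ^ 2 * gdot z z x := fun x =>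
    mul_nonneg (sq_nonneg _) (Finset.sum_nonneg fun i _ => mul_self_nonneg _)
  have hzero : ∫ x in B4, Real.exp (e.w x) ^ 2 * gdot z z x = 0 :=
    le_antisymm (by linarith) (integral_nonneg hnn)
  have hae := (integral_eq_zero_iff_of_nonneg hnn (integrable_ball hgc)).1 hzero
  have heq : EqOn (fun x => Real.exp (e.w x) ^ 2 * gdot z z x) 0 B4 :=
    Measure.eqOn_of_ae_eq hae hgc.continuousOn continuousOn_const (by
      rw [interior_closedBall _ one_ne_zero, closure_ball _ one_ne_zero])
  have hpd : ∀ x ∈ B4, fderiv ℝ z x = 0 := by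
    intro x hx
    have h1 : Real.exp (e.w x) ^ 2 * gdot z z x = 0 := heq hx
    have h2 : gdot z z x = 0 := by
      rcases mul_eq_zero.1 h1 with h | h
      · exact absurd h (by positivity)
      · exact h
    have h3 := (Finset.sum_eq_zero_iff_of_nonneg fun i _ => mul_self_nonneg (pd i z x)).1 h2
    ext v
    rw [fderiv_eq_sum_pd]
    exact Finset.sum_eq_zero fun i hi => by
      rw [mul_self_eq_zero.1 (h3 i hi), mul_zero]
  refine ⟨a, ha, z 0, fun x hx => ?_⟩
  have hconst := (convex_closedBall (0 : E4) 1).norm_image_sub_le_of_norm_fderiv_le (𝕜 := ℝ)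
    (C := 0) (fun y _ => cd_at hzs y) (fun y hy => by rw [hpd y hy]; simp)
    (Metric.mem_closedBall_self zero_le_one) hx
  rw [zero_mul, norm_le_zero_iff, sub_eq_zero] at hconst
  have h1 : u x - e.w x = z 0 := hconst
  rw [← (e.w_eq x hx).self_of_nhds]
  linarith

theorem conf_eq_smul_pullback {u : E4 → ℝ} {a x : E4} {c : ℝ} (ha : ‖a‖ < 1) (hx : x ∈ B4)
    (h : u x = mobLog a x + c) :
    conf u x = Real.exp (2 * c) • pullbackFlat (mob a) x := by
  rw [pullbackFlat_mob ha hx, smul_smul, ← Real.exp_add, conf, h]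
  congr 2; ring

end

end BallConformal

theorem theorem2 (u : EuclideanSpace ℝ (Fin 4) → ℝ) (hC : u ∈ BallConformal.coneC1) :
    (BallConformal.IsLocalMinToSecondOrderOn BallConformal.F2 BallConformal.volV u →
      ∃ Φ : EuclideanSpace ℝ (Fin 4) → EuclideanSpace ℝ (Fin 4),
        BallConformal.IsConformalDiffeo Φ ∧
        ∀ x ∈ BallConformal.B4, BallConformal.conf u x = BallConformal.pullbackFlat Φ x) ∧
    (BallConformal.IsLocalMinToSecondOrderOn BallConformal.G2 BallConformal.smoothFns u →
      ∃ Φ : EuclideanSpace ℝ (Fin 4) → EuclideanSpace ℝ (Fin 4),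
        BallConformal.IsConformalDiffeo Φ ∧ ∃ c : ℝ, 0 < c ∧
        ∀ x ∈ BallConformal.B4, BallConformal.conf u x = c • BallConformal.pullbackFlat Φ x) := by
  open BallConformal in
  have hu : ContDiff ℝ ∞ u := hC.1
  refine ⟨fun h => ?_, fun h => ?_⟩
  · obtain ⟨a, ha, c, hc⟩ := eq_mobLog_add_const hu (isAffineMin_of_F2 h)
    -- the volume constraint forces `c = 0`
    have hV := h.1.2
    obtain ⟨e⟩ := nonempty_mobExtension ha
    have hSB : ∀ ξ : S3, (ξ : E4) ∈ B4 := fun ξ => Metric.sphere_subset_closedBall ξ.2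
    have h1 : ∀ ξ : S3, Real.exp (3 * u ξ) = Real.exp (e.w ξ) ^ 3 * Real.exp (3 * c) := fun ξ => by
      rw [hc _ (hSB ξ), ← (e.w_eq _ (hSB ξ)).self_of_nhds, ← Real.exp_nat_mul, ← Real.exp_add]
      congr 1; push_cast; ring
    rw [bdryVol_conf] at hV
    simp only [h1, MeasureTheory.integral_mul_const, e.integral_exp_w ha] at hV
    have hexp : Real.exp (3 * c) = 1 := mul_left_cancel₀ omega3_pos.ne' (by rw [hV, mul_one])
    have hc0 : c = 0 := by
      rw [Real.exp_eq_one_iff] at hexp; linarith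
    refine ⟨mob a, isConformalDiffeo_mob ha, fun x hx => ?_⟩
    rw [conf_eq_smul_pullback ha hx (hc x hx), hc0]
    simp
  · obtain ⟨a, ha, c, hc⟩ := eq_mobLog_add_const hu (isAffineMin_of_G2 h)
    exact ⟨mob a, isConformalDiffeo_mob ha, Real.exp (2 * c), Real.exp_pos _,
      fun x hx => conf_eq_smul_pullback ha hx (hc x hx)⟩
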